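/- **Setting.** Let $\ell,s>0$, $L=2(\ell+s)$, and let $v,v_1,v_2\in\mathbb C\setminus\{0\}$. For $m\in\mathbb Z$ let $D_1^{(m)}=(mL,\,mL+\ell)$ and $D_2^{(m)}=(mL+\ell+s,\,mL+2\ell+s)$ (equally spaced dimers of identical size), with the material defect: the wave speeds $(v_1^{(m)},v_2^{(m)})$ in $(D_1^{(m)},D_2^{(m)})$ are $(v_1,v_2)$ for $m\le 0$ and $(v_2,v_1)$ for $m>0$. For $\delta>0$ and $\omega\in\mathbb C$, a *localised mode* at frequency $\omega$ is a continuous $u:\mathbb R\to\mathbb C$, $u\not\equiv 0$, $\int_{\mathbb R}|u|^2<\infty$, with $u''+\frac{\omega^2}{(v_i^{(m)})^2}u=0$ in $D_i^{(m)}$, $u''+\frac{\omega^2}{v^2}u=0$ in the gaps, and, at every end point of a resonator, (derivative from inside the resonator) $=\delta\,\cdot$ (derivative from outside). Write $u_i^m=\frac1\ell\int_{D_i^{(m)}}u$ and, for $\alpha\in\mathbb R$, $$U_1=\sum_{m\le0}u_1^me^{i\alpha mL},\quad U_2=\sum_{m>0}u_1^me^{i\alpha mL},\quad U_3=\sum_{m\le0}u_2^me^{i\alpha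 mL},\quad U_4=\sum_{m>0}u_2^me^{i\alpha mL}.$$ Let $\mathcal C^\alpha$ be the quasiperiodic capacitance matrix $\mathcal C^\alpha_{ij}=-\int_{\partial D_i^{(0)}}\partial_\nu V_j^\alpha\,d\sigma$ ($i,j\in\{1,2\}$; outward normal derivative taken from outside), where $V_j^\alpha$ is continuous, affine in every gap, equal to $\delta_{ij}$ on $D_i^{(0)}$, and satisfies $V_j^\alpha(x+mL)=e^{i\alpha mL}V_j^\alpha(x)$. For $b\in\mathbb C$ put $$A=\begin{pmatrix}1&b\\ b&1\end{pmatrix},\qquad B=\frac1\delta\begin{pmatrix}v_2^{-2}&b\,v_1^{-2}\\ b\,v_1^{-2}&v_2^{-2}\end{pmatrix}.$$ **Proposition.** Suppose that, for all sufficiently small $\delta>0$, there is a localised mode $u=u_\delta$ at a frequency $\omega=\omega(\delta)$, where $\omega(\delta)\to0$ as $\delta\to0^+$. Then there are complex numbers $b=b(\delta)$, $b'=b'(\delta)$ and $\mu=\mu(\delta)$, independent of $\alpha$, with $$b'(\delta)-b(\delta)\to0\qquad\text{and}\qquad \ell\,\omega(\delta)^2=\mu(\delta)+o(\delta)\qquad(\delta\to0^+),$$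 such that for all sufficiently small $\delta>0$: 1. $\sum_{m\in\mathbb Z}|u_i^m|<\infty$ for $i=1,2$, and $U_1=b'U_3$, $U_4=b'U_2$ for all $\alpha\in\mathbb R$ (so $b$ is the decay ratio of the mode to leading order); 2. $|b|\le1$, and $|b|<1$ if $|v_1|\ne|v_2|$; 3. for every $\alpha\in\mathbb R$ the number $\mu$ is a generalised eigenvalue of the pair $(\mathcal C^\alpha A,B)$, that is, $\mathcal C^\alpha A\,x=\mu B\,x$ for some $x\in\mathbb C^2\setminus\{0\}$ (depending on $\alpha$); 4. if $b\neq -v_1^2/v_2^2$, then $B$ is invertible and $\mu$ is an eigenvalue of $B^{-1}\mathcal C^\alpha A$ for every $\alpha\in\mathbb R$; in other words, $B^{-1}\mathcal C^\alpha A$ has an eigenvalue independent of the quasiperiodicity $\alpha$. -/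

import Mathlib

open Filter Topology Set MeasureTheory

/-! Equally spaced dimers of one-dimensional resonators: two resonators of length `ℓ` per unit cell,
all gaps of length `s`.  The index `i : Fin 2` is the position in the dimer (`0` is the first
resonator, `1` the second one), and `m : ℤ` numbers the dimers. -/

namespace DimerChain

noncomputable section

/-- Size of the unit cell. -/
def period (ℓ s : ℝ) : ℝ := 2 * (ℓ + s)

/-- Left end of the `i`-th resonator of the `m`-th dimer (the first resonator of dimer `0`
starts at the origin). -/
def leftEnd (ℓ s : ℝ) (i : Fin 2) (m : ℤ) : ℝ := (i.val : ℝ) * (ℓ + s) + m * period ℓ s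

/-- Right end of the `i`-th resonator of the `m`-th dimer. -/
def rightEnd (ℓ s : ℝ) (i : Fin 2) (m : ℤ) : ℝ := leftEnd ℓ s i m + ℓ

/-- The resonator itself, an open interval. -/
def resonator (ℓ s : ℝ) (i : Fin 2) (m : ℤ) : Set ℝ := Ioo (leftEnd ℓ s i m) (rightEnd ℓ s i m)

/-- The gap between that resonator and the next one on the right. -/
def gap (ℓ s : ℝ) (i : Fin 2) (m : ℤ) : Set ℝ := Ioo (rightEnd ℓ s i m) (rightEnd ℓ s i m + s)

/-- `f` is twice differentiable at `x` with second derivative `c`. -/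
def HasSecondDerivAt (f : ℝ → ℂ) (c : ℂ) (x : ℝ) : Prop :=
  DifferentiableAt ℝ f x ∧ HasDerivAt (deriv f) c x

/-- The one-sided limit of the derivative of `f` at `x` from the left is `c`. -/
def DerivLimLeft (f : ℝ → ℂ) (x : ℝ) (c : ℂ) : Prop := Tendsto (deriv f) (𝓝[<] x) (𝓝 c)

/-- The one-sided limit of the derivative of `f` at `x` from the right is `c`. -/
def DerivLimRight (f : ℝ → ℂ) (x : ℝ) (c : ℂ) : Prop := Tendsto (deriv f) (𝓝[>] x) (𝓝 c)

/-! ### The quasiperiodic capacitance matrix -/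

/-- `V` is the `j`-th `α`-quasiperiodic capacitance potential: it is harmonic in the gaps, equal to
`δ_{ij}` on the `i`-th resonator of the unit cell, and `α`-quasiperiodic. -/
structure IsCapacitancePotential (ℓ s α : ℝ) (j : Fin 2) (V : ℝ → ℂ) : Prop where
  continuous : Continuous V
  harmonic : ∀ (i : Fin 2) (m : ℤ), ∀ x ∈ gap ℓ s i m, HasSecondDerivAt V 0 x
  on_resonators : ∀ i : Fin 2, ∀ x ∈ resonator ℓ s i 0, V x = if i = j then 1 else 0
  quasiperiodic : ∀ (x : ℝ) (m : ℤ),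
    V (x + m * period ℓ s) = Complex.exp (Complex.I * α * m * period ℓ s) * V x

/-- `C` is the `α`-quasiperiodic capacitance matrix: `C i j` is minus the integral over the boundary
of the `i`-th resonator (two points) of the outward normal derivative, taken from outside, of the
`j`-th capacitance potential. -/
def IsCapacitanceMatrix (ℓ s α : ℝ) (C : Matrix (Fin 2) (Fin 2) ℂ) : Prop :=
  ∃ V : Fin 2 → ℝ → ℂ, (∀ j, IsCapacitancePotential ℓ s α j (V j)) ∧
    ∀ i j, ∃ a b : ℂ, DerivLimLeft (V j) (leftEnd ℓ s i 0) a ∧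
      DerivLimRight (V j) (rightEnd ℓ s i 0) b ∧ C i j = -(-a + b)

/-- A sequence of resonator values extends to a continuous function that is constant on the
resonators and affine in the gaps. -/
theorem exists_interpolation {ℓ s : ℝ} (hℓ : 0 < ℓ) (hs : 0 < s) (a : ℤ → ℂ) :
    ∃ V : ℝ → ℂ, Continuous V ∧ ∀ (n : ℤ), ∀ x ∈ Icc (n * (ℓ + s)) ((n + 1) * (ℓ + s)),
      V x = a n + (a (n + 1) - a n) * (((max 0 (x - n * (ℓ + s) - ℓ)) / s : ℝ) : ℂ) := by
  have hh : 0 < ℓ + s := by positivity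
  let φ : ℤ → ℝ → ℂ := fun n x =>
    a n + (a (n + 1) - a n) * (((max 0 (x - n * (ℓ + s) - ℓ)) / s : ℝ) : ℂ)
  have hφ : ∀ n, Continuous (φ n) := fun n => by
    simp only [φ]
    fun_prop
  let V : ℝ → ℂ := fun x => φ ⌊x / (ℓ + s)⌋ x
  have hV : ∀ (n : ℤ), ∀ x ∈ Icc (n * (ℓ + s)) ((n + 1) * (ℓ + s)), V x = φ n x := by
    intro n x hx
    rcases eq_or_lt_of_le hx.2 with h | h
    · have hf : ⌊x / (ℓ + s)⌋ = n + 1 := by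
        rw [h, mul_div_assoc, div_self hh.ne', mul_one]
        exact_mod_cast Int.floor_intCast (n + 1)
      have e1 : max 0 (x - ((n + 1 : ℤ) : ℝ) * (ℓ + s) - ℓ) = 0 := by
        rw [h]; push_cast; apply max_eq_left; linarith
      have e2 : max 0 (x - (n : ℝ) * (ℓ + s) - ℓ) = s := by
        have : x - (n : ℝ) * (ℓ + s) - ℓ = s := by rw [h]; ring
        rw [this]; exact max_eq_right hs.le
      simp only [V, φ, hf, e1, e2, div_self hs.ne']
      simp
    · have hf : ⌊x / (ℓ + s)⌋ = n := by
        rw [Int.floor_eq_iff, le_div_iff₀ hh, div_lt_iff₀ hh]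
        exact ⟨hx.1, h⟩
      simp only [V, hf]
  refine ⟨V, ?_, hV⟩
  rw [continuous_iff_continuousAt]
  intro x
  set n := ⌊x / (ℓ + s)⌋ with hn
  have h1 : n * (ℓ + s) ≤ x := (le_div_iff₀ hh).1 (Int.floor_le _)
  have h2 : x < (n + 1) * (ℓ + s) := (div_lt_iff₀ hh).1 (Int.lt_floor_add_one _)
  rcases eq_or_lt_of_le h1 with h | h
  · have hxr : x ∈ Icc (n * (ℓ + s)) ((n + 1) * (ℓ + s)) := ⟨h1, h2.le⟩
    have hxl : x ∈ Icc (((n - 1 : ℤ) : ℝ) * (ℓ + s)) ((((n - 1 : ℤ) : ℝ) + 1) * (ℓ + s)) := by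
      push_cast; constructor <;> nlinarith
    have cr : ContinuousWithinAt V (Icc (n * (ℓ + s)) ((n + 1) * (ℓ + s))) x :=
      (hφ n).continuousWithinAt.congr (hV n) (hV n x hxr)
    have cl : ContinuousWithinAt V
        (Icc (((n - 1 : ℤ) : ℝ) * (ℓ + s)) ((((n - 1 : ℤ) : ℝ) + 1) * (ℓ + s))) x :=
      (hφ (n - 1)).continuousWithinAt.congr (hV _) (hV _ x hxl)
    refine (cl.union cr).continuousAt ?_
    refine mem_of_superset (Ioo_mem_nhds (a := x - (ℓ + s)) (b := x + (ℓ + s))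
      (by linarith) (by linarith)) ?_
    intro y hy
    rcases le_total y x with hyx | hyx
    · left; push_cast; constructor <;> nlinarith [hy.1, hy.2]
    · right; constructor <;> nlinarith [hy.1, hy.2]
  · refine (hφ n).continuousAt.congr ?_
    filter_upwards [Ioo_mem_nhds h h2] with y hy
    exact (hV n y ⟨hy.1.le, hy.2.le⟩).symm

/-- The capacitance matrix exists, with the well-known entries. -/
theorem isCapacitanceMatrix_explicit {ℓ s : ℝ} (hℓ : 0 < ℓ) (hs : 0 < s) (α : ℝ) :
    IsCapacitanceMatrix ℓ s α
      !![2 / s, -(1 + Complex.exp (-(Complex.I * α * period ℓ s))) / s;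
        -(1 + Complex.exp (Complex.I * α * period ℓ s)) / s, 2 / s] := by
  let a : Fin 2 → ℤ → ℂ := fun j n => if (n - (j.val : ℤ)) % 2 = 0 then
    Complex.exp (Complex.I * α * (((n - (j.val : ℤ)) / 2 : ℤ) : ℂ) * period ℓ s) else 0
  have hh : 0 < ℓ + s := by positivity
  choose V hVc hV using fun j => exists_interpolation hℓ hs (a j)
  have hleft : ∀ (i : Fin 2) (m : ℤ),
      leftEnd ℓ s i m = ((((i.val : ℤ) + 2 * m : ℤ)) : ℝ) * (ℓ + s) := by
    intro i m; simp only [leftEnd, period]; push_cast; ring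
  -- on the closure of a gap the interpolation is affine
  have haff : ∀ j (n : ℤ), ∀ x ∈ Ioo (n * (ℓ + s) + ℓ) ((n + 1) * (ℓ + s)),
      V j =ᶠ[𝓝 x] fun y => a j n + (a j (n + 1) - a j n) * (((y - n * (ℓ + s) - ℓ) / s : ℝ) : ℂ) := by
    intro j n x hx
    filter_upwards [Ioo_mem_nhds hx.1 hx.2] with y hy
    rw [hV j n y ⟨by linarith [hy.1], hy.2.le⟩, max_eq_right (by linarith [hy.1])]
  have hder : ∀ j (n : ℤ) (x : ℝ), HasDerivAt
      (fun y : ℝ => a j n + (a j (n + 1) - a j n) * (((y - n * (ℓ + s) - ℓ) / s : ℝ) : ℂ))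
      ((a j (n + 1) - a j n) / s) x := by
    intro j n x
    have h1 : HasDerivAt (fun y : ℝ => (y - n * (ℓ + s) - ℓ) / s) (1 / s) x :=
      (((hasDerivAt_id x).sub_const _).sub_const _).div_const s
    have h2 := (h1.ofReal_comp.const_mul (a j (n + 1) - a j n)).const_add (a j n)
    refine h2.congr_deriv ?_
    push_cast; ring
  have hder' : ∀ j (n : ℤ), ∀ x ∈ Ioo (n * (ℓ + s) + ℓ) ((n + 1) * (ℓ + s)),
      HasDerivAt (V j) ((a j (n + 1) - a j n) / s) x := fun j n x hx =>
    (hder j n x).congr_of_eventuallyEq (haff j n x hx)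
  refine ⟨V, fun j => ⟨hVc j, ?_, ?_, ?_⟩, ?_⟩
  · intro i m x hx
    simp only [gap, rightEnd, hleft] at hx
    set n : ℤ := (i.val : ℤ) + 2 * m with hn
    have hx' : x ∈ Ioo (n * (ℓ + s) + ℓ) ((n + 1) * (ℓ + s)) := ⟨hx.1, by linarith [hx.2]⟩
    refine ⟨(hder' j n x hx').differentiableAt, ?_⟩
    refine (hasDerivAt_const x ((a j (n + 1) - a j n) / (s : ℂ))).congr_of_eventuallyEq ?_
    filter_upwards [Ioo_mem_nhds hx'.1 hx'.2] with y hy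
    exact (hder' j n y hy).deriv
  · intro i x hx
    simp only [resonator, rightEnd, hleft] at hx
    rw [hV j ((i.val : ℤ) + 2 * 0) x ⟨hx.1.le, by linarith [hx.2]⟩,
      max_eq_left (by linarith [hx.2])]
    fin_cases i <;> fin_cases j <;> simp [a]
  · intro x m
    set n := ⌊x / (ℓ + s)⌋ with hn
    have h1 : n * (ℓ + s) ≤ x := (le_div_iff₀ hh).1 (Int.floor_le _)
    have h2 : x < (n + 1) * (ℓ + s) := (div_lt_iff₀ hh).1 (Int.lt_floor_add_one _)
    have ha : ∀ k : ℤ, a j (k + 2 * m) =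
        Complex.exp (Complex.I * α * m * period ℓ s) * a j k := by
      intro k
      have e1 : (k + 2 * m - (j.val : ℤ)) % 2 = (k - (j.val : ℤ)) % 2 := by omega
      have e2 : (k + 2 * m - (j.val : ℤ)) / 2 = (k - (j.val : ℤ)) / 2 + m := by omega
      simp only [a, e1, e2]
      split_ifs
      · rw [← Complex.exp_add]; congr 1; push_cast; ring
      · simp
    have e3 : x + m * period ℓ s - ((n + 2 * m : ℤ) : ℝ) * (ℓ + s) - ℓ
        = x - n * (ℓ + s) - ℓ := by
      simp only [period]; push_cast; ring
    rw [hV j n x ⟨h1, h2.le⟩, hV j (n + 2 * m) (x + m * period ℓ s)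
      (by simp only [period]; push_cast; constructor <;> linarith), e3,
      show n + 2 * m + 1 = (n + 1) + 2 * m by ring, ha, ha]
    ring
  · intro i j
    refine ⟨(a j i.val - a j (i.val - 1)) / s, (a j (i.val + 1) - a j i.val) / s, ?_, ?_, ?_⟩
    · have hm : Ioo ((((i.val : ℤ) - 1 : ℤ) : ℝ) * (ℓ + s) + ℓ) (leftEnd ℓ s i 0)
          ∈ 𝓝[<] (leftEnd ℓ s i 0) :=
        Ioo_mem_nhdsLT (by rw [hleft]; push_cast; linarith)
      refine tendsto_const_nhds.congr' ?_
      filter_upwards [hm] with y hy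
      have := (hder' j ((i.val : ℤ) - 1) y ⟨hy.1, by
        have := hy.2; rw [hleft] at this; push_cast at this ⊢; linarith⟩).deriv
      rw [this]; simp
    · have hm : Ioo (rightEnd ℓ s i 0) ((((i.val : ℤ) : ℝ) + 1) * (ℓ + s))
          ∈ 𝓝[>] (rightEnd ℓ s i 0) :=
        Ioo_mem_nhdsGT (by rw [rightEnd, hleft]; push_cast; linarith)
      refine tendsto_const_nhds.congr' ?_
      filter_upwards [hm] with y hy
      exact ((hder' j (i.val : ℤ) y ⟨by
        have := hy.1; rw [rightEnd, hleft] at this; push_cast at this ⊢; linarith, hy.2⟩).deriv).symm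
    · fin_cases i <;> fin_cases j <;> simp [a] <;> ring

/-! ### Localised modes of the chain with the swapped-material defect -/

/-- Wave speed in the `i`-th resonator of the `m`-th dimer: `v₁, v₂` in the dimers `m ≤ 0`, and
`v₂, v₁` in the dimers `m > 0`. -/
def defectSpeed (v₁ v₂ : ℂ) (i : Fin 2) (m : ℤ) : ℂ :=
  if i = 0 then (if m ≤ 0 then v₁ else v₂) else (if m ≤ 0 then v₂ else v₁)

/-- `u` is a localised mode at frequency `ω` and contrast `δ`: a nontrivial square-integrable
solution of the system of coupled Helmholtz equations, with background wave speed `v`. -/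
structure IsLocalisedMode (ℓ s : ℝ) (v v₁ v₂ : ℂ) (δ : ℝ) (ω : ℂ) (u : ℝ → ℂ) : Prop where
  continuous : Continuous u
  outside : ∀ (i : Fin 2) (m : ℤ), ∀ x ∈ gap ℓ s i m,
    HasSecondDerivAt u (-(ω ^ 2 / v ^ 2 * u x)) x
  inside : ∀ (i : Fin 2) (m : ℤ), ∀ x ∈ resonator ℓ s i m,
    HasSecondDerivAt u (-(ω ^ 2 / defectSpeed v₁ v₂ i m ^ 2 * u x)) x
  flux_left : ∀ (i : Fin 2) (m : ℤ), ∃ a : ℂ,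
    DerivLimLeft u (leftEnd ℓ s i m) a ∧ DerivLimRight u (leftEnd ℓ s i m) (δ * a)
  flux_right : ∀ (i : Fin 2) (m : ℤ), ∃ a : ℂ,
    DerivLimRight u (rightEnd ℓ s i m) a ∧ DerivLimLeft u (rightEnd ℓ s i m) (δ * a)
  square_integrable : MemLp u 2 volume
  nontrivial : u ≠ 0

/-- The amplitude `u_i^m` of `u` in the `i`-th resonator of the `m`-th dimer: its mean value. -/
def amplitude (ℓ s : ℝ) (u : ℝ → ℂ) (i : Fin 2) (m : ℤ) : ℂ :=
  (1 / ℓ : ℝ) * ∫ x in leftEnd ℓ s i m..rightEnd ℓ s i m, u x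

/-- `∑_{m ≤ 0} u_i^m e^{iαmL}`. -/
def leftSum (ℓ s : ℝ) (u : ℝ → ℂ) (i : Fin 2) (α : ℝ) : ℂ :=
  ∑' m : {m : ℤ // m ≤ 0},
    amplitude ℓ s u i m * Complex.exp (Complex.I * α * (m : ℤ) * period ℓ s)

/-- `∑_{m > 0} u_i^m e^{iαmL}`. -/
def rightSum (ℓ s : ℝ) (u : ℝ → ℂ) (i : Fin 2) (α : ℝ) : ℂ :=
  ∑' m : {m : ℤ // 0 < m},
    amplitude ℓ s u i m * Complex.exp (Complex.I * α * (m : ℤ) * period ℓ s)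

/-- `b` is the decay ratio of `u`: `U₁ = b U₃` and `U₄ = b U₂` for every quasiperiodicity, where
`U₁, U₂` are the left and right sums over the first resonators of the dimers, and `U₃, U₄` those
over the second ones; all these series converge absolutely. -/
def IsDecayRatio (ℓ s : ℝ) (u : ℝ → ℂ) (b : ℂ) : Prop :=
  (∀ i : Fin 2, Summable fun m : ℤ => ‖amplitude ℓ s u i m‖) ∧
    ∀ α : ℝ, leftSum ℓ s u 0 α = b * leftSum ℓ s u 1 α ∧
      rightSum ℓ s u 1 α = b * rightSum ℓ s u 0 α

/-- The matrix `A`. -/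
def matA (b : ℂ) : Matrix (Fin 2) (Fin 2) ℂ := !![1, b; b, 1]

/-- The matrix `B`. -/
def matB (δ : ℝ) (v₁ v₂ b : ℂ) : Matrix (Fin 2) (Fin 2) ℂ :=
  ((1 / δ : ℝ) : ℂ) • !![(v₂ ^ 2)⁻¹, b * (v₁ ^ 2)⁻¹; b * (v₁ ^ 2)⁻¹, (v₂ ^ 2)⁻¹]

end

end DimerChain

namespace DimerChain

/-- The entire extension of `sin (k x) / k`. -/
noncomputable def sinOver (k : ℂ) (x : ℝ) : ℂ := x * dslope Complex.sin 0 (k * x)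

theorem mul_sinOver (k : ℂ) (x : ℝ) : k * sinOver k x = Complex.sin (k * x) := by
  have h := sub_smul_dslope Complex.sin 0 (k * x)
  simp only [sub_zero, Complex.sin_zero, smul_eq_mul] at h
  rw [sinOver, ← h]; ring

@[simp] theorem sinOver_zero_left (x : ℝ) : sinOver 0 x = x := by
  simp [sinOver]

@[simp] theorem sinOver_zero_right (k : ℂ) : sinOver k 0 = 0 := by
  simp [sinOver]

theorem sinOver_neg_left (k : ℂ) (x : ℝ) : sinOver (-k) x = sinOver k x := by
  rcases eq_or_ne k 0 with rfl | hk
  · simp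
  · apply mul_left_cancel₀ hk
    have h1 := mul_sinOver (-k) x
    rw [neg_mul, neg_mul, Complex.sin_neg, neg_inj] at h1
    rw [h1, mul_sinOver]

theorem hasDerivAt_sinOver (k : ℂ) (x : ℝ) :
    HasDerivAt (sinOver k) (Complex.cos (k * x)) x := by
  rcases eq_or_ne k 0 with rfl | hk
  · have h : sinOver 0 = fun x : ℝ => (x : ℂ) := by ext x; simp
    rw [h]
    simpa using (hasDerivAt_id x).ofReal_comp
  · have h : sinOver k = fun x : ℝ => Complex.sin (k * x) / k := by
      ext x; rw [← mul_sinOver, mul_div_cancel_left₀ _ hk]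
    rw [h]
    have h1 : HasDerivAt (fun z : ℂ => k * z) k (x : ℂ) := by
      simpa using (hasDerivAt_id (x : ℂ)).const_mul k
    exact ((h1.csin.div_const k).congr_deriv (by field_simp)).comp_ofReal

theorem hasDerivAt_cos_mul (k : ℂ) (x : ℝ) :
    HasDerivAt (fun x : ℝ => Complex.cos (k * x)) (-(k ^ 2 * sinOver k x)) x := by
  have h1 : HasDerivAt (fun z : ℂ => k * z) k (x : ℂ) := by
    simpa using (hasDerivAt_id (x : ℂ)).const_mul k
  exact (h1.ccos.congr_deriv (by rw [← mul_sinOver]; ring)).comp_ofReal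

theorem cos_sq_add_sinOver_sq (k : ℂ) (x : ℝ) :
    Complex.cos (k * x) ^ 2 + k ^ 2 * sinOver k x ^ 2 = 1 := by
  rw [← mul_pow, mul_sinOver, Complex.cos_sq_add_sin_sq]

theorem continuous_sinOver (k : ℂ) : Continuous (sinOver k) :=
  continuous_iff_continuousAt.2 fun x => (hasDerivAt_sinOver k x).continuousAt

theorem tendsto_sinOver {ι : Type*} {l : Filter ι} {k : ι → ℂ} (hk : Tendsto k l (𝓝 0)) (x : ℝ) :
    Tendsto (fun i => sinOver (k i) x) l (𝓝 x) := by
  have h : ContinuousAt (dslope Complex.sin 0) 0 :=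
    continuousAt_dslope_same.2 Complex.differentiableAt_sin
  have h1 : Tendsto (fun i => k i * (x : ℂ)) l (𝓝 0) := by simpa using hk.mul_const (x : ℂ)
  have h2 := (h.tendsto.comp h1).const_mul (x : ℂ)
  simpa [sinOver] using h2

theorem tendsto_cos_mul {ι : Type*} {l : Filter ι} {k : ι → ℂ} (hk : Tendsto k l (𝓝 0)) (x : ℝ) :
    Tendsto (fun i => Complex.cos (k i * x)) l (𝓝 1) := by
  have h1 : Tendsto (fun i => k i * (x : ℂ)) l (𝓝 0) := by simpa using hk.mul_const (x : ℂ)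
  simpa [Function.comp_def] using (Complex.continuous_cos.tendsto 0).comp h1

theorem one_sub_cos_mul (k : ℂ) (x : ℝ) :
    1 - Complex.cos (k * x) = 2 * k ^ 2 * sinOver k (x / 2) ^ 2 := by
  have h := Complex.cos_two_mul (k * (x / 2 : ℝ))
  rw [show 2 * (k * ((x / 2 : ℝ) : ℂ)) = k * x by push_cast; ring] at h
  have h2 := cos_sq_add_sinOver_sq k (x / 2)
  rw [h]; linear_combination (-2) * h2

theorem sinOver_eq_half (k : ℂ) (x : ℝ) :
    sinOver k x = 2 * sinOver k (x / 2) * Complex.cos (k * (x / 2 : ℝ)) := by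
  rcases eq_or_ne k 0 with rfl | hk
  · simp; ring
  · apply mul_left_cancel₀ hk
    rw [show k * (2 * sinOver k (x / 2) * Complex.cos (k * (x / 2 : ℝ)))
      = 2 * (k * sinOver k (x / 2)) * Complex.cos (k * (x / 2 : ℝ)) by ring, mul_sinOver,
      mul_sinOver, ← Complex.sin_two_mul]
    congr 1; push_cast; ring

theorem hasDerivAt_two_mul_sinOver_half_sq (k : ℂ) (x : ℝ) :
    HasDerivAt (fun x : ℝ => 2 * sinOver k (x / 2) ^ 2) (sinOver k x) x := by
  have h1 : HasDerivAt (fun x : ℝ => x / 2) (1 / 2) x := (hasDerivAt_id x).div_const 2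
  have h2 := (HasDerivAt.scomp x (hasDerivAt_sinOver k (x / 2)) h1)
  have h3 := (h2.pow 2).const_mul 2
  refine h3.congr_deriv ?_
  rw [sinOver_eq_half k x]
  simp [Function.comp]
  ring

/-- A solution of `u'' + k² u = 0` in an open interval, continuous up to the end points, is a
combination of the two fundamental solutions. -/
theorem exists_fundamental_representation {u : ℝ → ℂ} {a b : ℝ} (hab : a < b) {k : ℂ}
    (hc : ContinuousOn u (Icc a b))
    (h2 : ∀ x ∈ Ioo a b, HasSecondDerivAt u (-(k ^ 2 * u x)) x) :
    ∃ B : ℂ, (∀ x ∈ Icc a b,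
        u x = Complex.cos (k * (x - a : ℝ)) * u a + sinOver k (x - a) * B) ∧
      ∀ x ∈ Ioo a b,
        deriv u x = -(k ^ 2 * sinOver k (x - a)) * u a + Complex.cos (k * (x - a : ℝ)) * B := by
  have hs : ∀ x, HasDerivAt (fun x => sinOver k (x - a)) (Complex.cos (k * (x - a : ℝ))) x :=
    fun x => (hasDerivAt_sinOver k (x - a)).comp_sub_const x a
  have hcos : ∀ x, HasDerivAt (fun x : ℝ => Complex.cos (k * (x - a : ℝ)))
      (-(k ^ 2 * sinOver k (x - a))) x :=
    fun x => (hasDerivAt_cos_mul k (x - a)).comp_sub_const x a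
  have hφ : ∀ x ∈ Ioo a b, HasDerivAt (fun x => u x * Complex.cos (k * (x - a : ℝ))
      - deriv u x * sinOver k (x - a)) 0 x := fun x hx =>
    (((h2 x hx).1.hasDerivAt.mul (hcos x)).sub ((h2 x hx).2.mul (hs x))).congr_deriv (by ring)
  have hψ : ∀ x ∈ Ioo a b, HasDerivAt (fun x => u x * (k ^ 2 * sinOver k (x - a))
      + deriv u x * Complex.cos (k * (x - a : ℝ))) 0 x := fun x hx =>
    (((h2 x hx).1.hasDerivAt.mul ((hs x).const_mul (k ^ 2))).add
      ((h2 x hx).2.mul (hcos x))).congr_deriv (by ring)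
  have hconst : ∀ f : ℝ → ℂ, (∀ x ∈ Ioo a b, HasDerivAt f 0 x) → ∃ c, ∀ x ∈ Ioo a b, f x = c :=
    fun f hf => isOpen_Ioo.exists_is_const_of_deriv_eq_zero isPreconnected_Ioo
      (fun x hx => (hf x hx).differentiableAt.differentiableWithinAt)
      (fun x hx => (hf x hx).deriv)
  obtain ⟨A, hA⟩ := hconst _ hφ
  obtain ⟨B, hB⟩ := hconst _ hψ
  have hu : ∀ x ∈ Ioo a b, u x = Complex.cos (k * (x - a : ℝ)) * A + sinOver k (x - a) * B := by
    intro x hx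
    rw [← hA x hx, ← hB x hx]
    linear_combination (-u x) * cos_sq_add_sinOver_sq k (x - a)
  have hcont : Continuous fun x : ℝ =>
      Complex.cos (k * (x - a : ℝ)) * A + sinOver k (x - a) * B := by
    have := continuous_sinOver k
    fun_prop
  have hu' : EqOn u (fun x : ℝ => Complex.cos (k * (x - a : ℝ)) * A + sinOver k (x - a) * B)
      (Icc a b) :=
    EqOn.of_subset_closure (s := Ioo a b) hu hc hcont.continuousOn Ioo_subset_Icc_self
      (by rw [closure_Ioo hab.ne])
  have hA' : u a = A := by
    rw [hu' ⟨le_rfl, hab.le⟩]; simp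
  refine ⟨B, fun x hx => by rw [hA']; exact hu' hx, fun x hx => ?_⟩
  rw [hA', ← hA x hx, ← hB x hx]
  linear_combination (-deriv u x) * cos_sq_add_sinOver_sq k (x - a)

/-- Transfer across an interval on which `u'' + k² u = 0`, and the integral over that interval. -/
theorem transfer_interval {u : ℝ → ℂ} {a b : ℝ} (hab : a < b) {k : ℂ} {w : ℂ}
    (hc : ContinuousOn u (Icc a b))
    (h2 : ∀ x ∈ Ioo a b, HasSecondDerivAt u (-(k ^ 2 * u x)) x) (hw : DerivLimRight u a w) :
    (∀ x ∈ Icc a b, u x = Complex.cos (k * (x - a : ℝ)) * u a + sinOver k (x - a) * w) ∧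
      DerivLimLeft u b
        (-(k ^ 2 * sinOver k (b - a)) * u a + Complex.cos (k * (b - a : ℝ)) * w) ∧
      ∫ x in a..b, u x = sinOver k (b - a) * u a + 2 * sinOver k ((b - a) / 2) ^ 2 * w := by
  obtain ⟨B, h, h'⟩ := exists_fundamental_representation hab hc h2
  have hcont : Continuous fun x : ℝ =>
      -(k ^ 2 * sinOver k (x - a)) * u a + Complex.cos (k * (x - a : ℝ)) * B := by
    have := continuous_sinOver k
    fun_prop
  have hlim : ∀ c, Tendsto (fun x : ℝ =>
      -(k ^ 2 * sinOver k (x - a)) * u a + Complex.cos (k * (x - a : ℝ)) * B) (𝓝 c)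
      (𝓝 (-(k ^ 2 * sinOver k (c - a)) * u a + Complex.cos (k * (c - a : ℝ)) * B)) :=
    fun c => hcont.tendsto c
  have hB : B = w := by
    have h1 : DerivLimRight u a B := by
      have := (hlim a).mono_left (nhdsWithin_le_nhds (s := Ioi a))
      simp only [sub_self, sinOver_zero_right, mul_zero, neg_zero, zero_mul, Complex.ofReal_zero,
        Complex.cos_zero, one_mul, zero_add] at this
      refine this.congr' ?_
      filter_upwards [Ioo_mem_nhdsGT hab] with x hx using (h' x hx).symm
    exact tendsto_nhds_unique h1 hw
  subst hB
  refine ⟨h, ?_, ?_⟩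
  · refine ((hlim b).mono_left nhdsWithin_le_nhds).congr' ?_
    filter_upwards [Ioo_mem_nhdsLT hab] with x hx using (h' x hx).symm
  · have hd : ∀ x ∈ uIcc a b, HasDerivAt
        (fun x => sinOver k (x - a) * u a + 2 * sinOver k ((x - a) / 2) ^ 2 * B)
        (Complex.cos (k * (x - a : ℝ)) * u a + sinOver k (x - a) * B) x := fun x _ =>
      (((hasDerivAt_sinOver k (x - a)).comp_sub_const x a).mul_const _).add
        (((hasDerivAt_two_mul_sinOver_half_sq k (x - a)).comp_sub_const x a).mul_const _)
    have hcont2 : Continuous fun x : ℝ =>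
        Complex.cos (k * (x - a : ℝ)) * u a + sinOver k (x - a) * B := by
      have := continuous_sinOver k
      fun_prop
    have hi := intervalIntegral.integral_eq_sub_of_hasDerivAt hd (hcont2.intervalIntegrable a b)
    rw [intervalIntegral.integral_congr (g := fun x : ℝ =>
      Complex.cos (k * (x - a : ℝ)) * u a + sinOver k (x - a) * B)
      (fun x hx => h x (by rwa [uIcc_of_le hab.le] at hx)), hi]
    simp

/-- Wave speed in the `n`-th resonator, counted along the line: `…, v₁, v₂, v₂, v₁, v₂, …` with the
two equal neighbours in the positions `1` and `2`. -/
noncomputable def chainSpeed (v₁ v₂ : ℂ) (n : ℤ) : ℂ :=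
  if (n % 2 = 0 ↔ n ≤ 1) then v₁ else v₂

theorem chainSpeed_two_mul_add (v₁ v₂ : ℂ) (i : Fin 2) (m : ℤ) :
    chainSpeed v₁ v₂ (i.val + 2 * m) = defectSpeed v₁ v₂ i m := by
  have h : ((i.val : ℤ) + 2 * m) % 2 = i.val := by fin_cases i <;> simp
  rw [chainSpeed, defectSpeed, h]
  fin_cases i
  · by_cases hm : m ≤ 0
    · have : 2 * m ≤ 1 := by omega
      simp [hm, this]
    · have : ¬ 2 * m ≤ 1 := by omega
      simp [hm, this]
  · by_cases hm : m ≤ 0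
    · have : 1 + 2 * m ≤ 1 := by omega
      simp [hm]
    · have : ¬ 1 + 2 * m ≤ 1 := by omega
      simp [hm]

theorem chainSpeed_reflect (v₁ v₂ : ℂ) (n : ℤ) :
    chainSpeed v₁ v₂ (3 - n) = chainSpeed v₁ v₂ n := by
  have h : ((3 - n) % 2 = 0 ↔ 3 - n ≤ 1) ↔ (n % 2 = 0 ↔ n ≤ 1) := by omega
  simp only [chainSpeed, h]

theorem chainSpeed_even {v₁ v₂ : ℂ} (m : ℕ) : chainSpeed v₁ v₂ (2 + 2 * m) = v₂ := by
  have h : ¬ ((2 + 2 * (m : ℤ)) % 2 = 0 ↔ 2 + 2 * (m : ℤ) ≤ 1) := by omega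
  rw [chainSpeed, if_neg h]

theorem chainSpeed_odd {v₁ v₂ : ℂ} (m : ℕ) : chainSpeed v₁ v₂ (3 + 2 * m) = v₁ := by
  have h : ((3 + 2 * (m : ℤ)) % 2 = 0 ↔ 3 + 2 * (m : ℤ) ≤ 1) := by omega
  rw [chainSpeed, if_pos h]

theorem leftEnd_eq (ℓ s : ℝ) (i : Fin 2) (m : ℤ) :
    leftEnd ℓ s i m = ((i.val + 2 * m : ℤ) : ℝ) * (ℓ + s) := by
  simp only [leftEnd, period]; push_cast; ring

theorem exists_position (n : ℤ) : ∃ (i : Fin 2) (m : ℤ), n = i.val + 2 * m := by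
  rcases Int.emod_two_eq_zero_or_one n with h | h
  · exact ⟨0, n / 2, by simp; omega⟩
  · exact ⟨1, n / 2, by simp; omega⟩

section Cell

variable (ℓ s : ℝ) (κ k : ℂ) (δ : ℝ)

/-- Derivative of the cosine solution across half a gap. -/
noncomputable def halfGapDown : ℂ := -(κ ^ 2 * sinOver κ (s / 2))

/-- Diagonal entry of the transfer matrix of a resonator with half a gap on either side. -/
noncomputable def cellDiag : ℂ :=
  Complex.cos (k * ℓ) * (Complex.cos (κ * (s / 2 : ℝ)) ^ 2 + sinOver κ (s / 2) * halfGapDown s κ)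
    + δ * sinOver k ℓ * Complex.cos (κ * (s / 2 : ℝ)) * halfGapDown s κ
    - k ^ 2 * sinOver k ℓ / δ * Complex.cos (κ * (s / 2 : ℝ)) * sinOver κ (s / 2)

/-- Upper off-diagonal entry of that transfer matrix. -/
noncomputable def cellUp : ℂ :=
  2 * Complex.cos (k * ℓ) * Complex.cos (κ * (s / 2 : ℝ)) * sinOver κ (s / 2)
    + δ * sinOver k ℓ * Complex.cos (κ * (s / 2 : ℝ)) ^ 2
    - k ^ 2 * sinOver k ℓ / δ * sinOver κ (s / 2) ^ 2

/-- Lower off-diagonal entry of that transfer matrix. -/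
noncomputable def cellDown : ℂ :=
  2 * Complex.cos (k * ℓ) * Complex.cos (κ * (s / 2 : ℝ)) * halfGapDown s κ
    + δ * sinOver k ℓ * halfGapDown s κ ^ 2
    - k ^ 2 * sinOver k ℓ / δ * Complex.cos (κ * (s / 2 : ℝ)) ^ 2

/-- Contribution of the value at the centre of the gap to the mean over the next resonator. -/
noncomputable def meanValueCoeff : ℂ :=
  (sinOver k ℓ * Complex.cos (κ * (s / 2 : ℝ))
    + 2 * sinOver k (ℓ / 2) ^ 2 * δ * halfGapDown s κ) / ℓ

/-- Contribution of the derivative at the centre of the gap to the mean over the next resonator. -/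
noncomputable def meanDerivCoeff : ℂ :=
  (sinOver k ℓ * sinOver κ (s / 2)
    + 2 * sinOver k (ℓ / 2) ^ 2 * δ * Complex.cos (κ * (s / 2 : ℝ))) / ℓ

theorem halfGap_det :
    Complex.cos (κ * (s / 2 : ℝ)) ^ 2 - sinOver κ (s / 2) * halfGapDown s κ = 1 := by
  rw [halfGapDown]; linear_combination cos_sq_add_sinOver_sq κ (s / 2)

variable {δ} in
theorem cell_det (hδ : δ ≠ 0) :
    cellDiag ℓ s κ k δ ^ 2 - cellUp ℓ s κ k δ * cellDown ℓ s κ k δ = 1 := by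
  have h1 := halfGap_det s κ
  have h2 := cos_sq_add_sinOver_sq k ℓ
  have hδ' : (δ : ℂ) ≠ 0 := by exact_mod_cast hδ
  have h3 : (δ * sinOver k ℓ) * (k ^ 2 * sinOver k ℓ / δ) = k ^ 2 * sinOver k ℓ ^ 2 := by
    field_simp
  rw [cellDiag, cellUp, cellDown]
  generalize δ * sinOver k ℓ = d at *
  generalize k ^ 2 * sinOver k ℓ / δ = e at *
  generalize Complex.cos (κ * (s / 2 : ℝ)) = p at *
  generalize halfGapDown s κ = r at *
  generalize sinOver κ (s / 2) = q at *
  generalize Complex.cos (k * ℓ) = C at *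
  rw [← h3] at h2
  have : (C * (p ^ 2 + q * r) + d * p * r - e * p * q) ^ 2
      - (2 * C * p * q + d * p ^ 2 - e * q ^ 2) * (2 * C * p * r + d * r ^ 2 - e * p ^ 2)
      = (C ^ 2 + d * e) * (p ^ 2 - q * r) ^ 2 := by ring
  rw [this, h1, h2]; ring

theorem cellDiag_neg : cellDiag ℓ s κ (-k) δ = cellDiag ℓ s κ k δ := by
  simp [cellDiag, sinOver_neg_left]

theorem cellUp_neg : cellUp ℓ s κ (-k) δ = cellUp ℓ s κ k δ := by
  simp [cellUp, sinOver_neg_left]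

theorem cellDown_neg : cellDown ℓ s κ (-k) δ = cellDown ℓ s κ k δ := by
  simp [cellDown, sinOver_neg_left]

end Cell

/-- Centre of the gap on the left of the `n`-th resonator. -/
noncomputable def gapCentre (ℓ s : ℝ) (n : ℤ) : ℝ := n * (ℓ + s) - s / 2

/-- Amplitude of the `n`-th resonator. -/
noncomputable def chainAmplitude (ℓ s : ℝ) (u : ℝ → ℂ) (n : ℤ) : ℂ :=
  (1 / ℓ : ℝ) * ∫ x in n * (ℓ + s)..n * (ℓ + s) + ℓ, u x

theorem amplitude_eq (ℓ s : ℝ) (u : ℝ → ℂ) (i : Fin 2) (m : ℤ) :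
    amplitude ℓ s u i m = chainAmplitude ℓ s u (i.val + 2 * m) := by
  rw [amplitude, chainAmplitude, rightEnd, leftEnd_eq]

section Mode

variable {ℓ s : ℝ} {v v₁ v₂ : ℂ} {δ : ℝ} {ω : ℂ} {u : ℝ → ℂ}

theorem IsLocalisedMode.gap_equation (hu : IsLocalisedMode ℓ s v v₁ v₂ δ ω u) (n : ℤ) (x : ℝ)
    (hx : x ∈ Ioo (n * (ℓ + s) + ℓ) ((n + 1) * (ℓ + s))) :
    HasSecondDerivAt u (-((ω / v) ^ 2 * u x)) x := by
  obtain ⟨i, m, rfl⟩ := exists_position n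
  rw [div_pow]
  refine hu.outside i m x ?_
  rw [gap, rightEnd, leftEnd_eq]
  exact ⟨hx.1, by linarith [hx.2]⟩

theorem IsLocalisedMode.resonator_equation (hu : IsLocalisedMode ℓ s v v₁ v₂ δ ω u) (n : ℤ) (x : ℝ)
    (hx : x ∈ Ioo (n * (ℓ + s)) (n * (ℓ + s) + ℓ)) :
    HasSecondDerivAt u (-((ω / chainSpeed v₁ v₂ n) ^ 2 * u x)) x := by
  obtain ⟨i, m, rfl⟩ := exists_position n
  rw [div_pow, chainSpeed_two_mul_add]
  refine hu.inside i m x ?_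
  rw [resonator, rightEnd, leftEnd_eq]
  exact hx

theorem HasSecondDerivAt.derivLimRight {f : ℝ → ℂ} {c : ℂ} {x : ℝ} (h : HasSecondDerivAt f c x) :
    DerivLimRight f x (deriv f x) :=
  h.2.continuousAt.tendsto.mono_left nhdsWithin_le_nhds

theorem HasSecondDerivAt.derivLimLeft {f : ℝ → ℂ} {c : ℂ} {x : ℝ} (h : HasSecondDerivAt f c x) :
    DerivLimLeft f x (deriv f x) :=
  h.2.continuousAt.tendsto.mono_left nhdsWithin_le_nhds

/-- Value and derivative at the end of the cell around the `n`-th resonator, and the mean over that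
resonator, in terms of the value and the derivative at the beginning of the cell. -/
theorem IsLocalisedMode.transfer_cell (hu : IsLocalisedMode ℓ s v v₁ v₂ δ ω u) (hℓ : 0 < ℓ)
    (hs : 0 < s) (hδ : δ ≠ 0) (n : ℤ) :
    u (gapCentre ℓ s (n + 1)) = cellDiag ℓ s (ω / v) (ω / chainSpeed v₁ v₂ n) δ
        * u (gapCentre ℓ s n)
      + cellUp ℓ s (ω / v) (ω / chainSpeed v₁ v₂ n) δ * deriv u (gapCentre ℓ s n) ∧
    deriv u (gapCentre ℓ s (n + 1)) = cellDown ℓ s (ω / v) (ω / chainSpeed v₁ v₂ n) δ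
        * u (gapCentre ℓ s n)
      + cellDiag ℓ s (ω / v) (ω / chainSpeed v₁ v₂ n) δ * deriv u (gapCentre ℓ s n) ∧
    chainAmplitude ℓ s u n = meanValueCoeff ℓ s (ω / v) (ω / chainSpeed v₁ v₂ n) δ
        * u (gapCentre ℓ s n)
      + meanDerivCoeff ℓ s (ω / v) (ω / chainSpeed v₁ v₂ n) δ * deriv u (gapCentre ℓ s n) ∧
    chainAmplitude ℓ s u n = meanValueCoeff ℓ s (ω / v) (ω / chainSpeed v₁ v₂ n) δ
        * u (gapCentre ℓ s (n + 1))
      - meanDerivCoeff ℓ s (ω / v) (ω / chainSpeed v₁ v₂ n) δ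
        * deriv u (gapCentre ℓ s (n + 1)) ∧
    (u (gapCentre ℓ s n) = 0 → deriv u (gapCentre ℓ s n) = 0 →
      ∀ x ∈ Icc (gapCentre ℓ s n) (gapCentre ℓ s (n + 1)), u x = 0) := by
  set κ := ω / v with hκ
  set k := ω / chainSpeed v₁ v₂ n with hk
  have hδ' : (δ : ℂ) ≠ 0 := by exact_mod_cast hδ
  have hℓ' : (ℓ : ℂ) ≠ 0 := by exact_mod_cast hℓ.ne'
  set x₀ := gapCentre ℓ s n with hx₀
  set x₁ : ℝ := n * (ℓ + s) with hx₁
  set x₂ : ℝ := n * (ℓ + s) + ℓ with hx₂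
  set x₃ := gapCentre ℓ s (n + 1) with hx₃
  have e01 : x₁ - x₀ = s / 2 := by simp only [hx₀, hx₁, gapCentre]; ring
  have e12 : x₂ - x₁ = ℓ := by simp only [hx₂, hx₁]; ring
  have e23 : x₃ - x₂ = s / 2 := by simp only [hx₃, hx₂, gapCentre]; push_cast; ring
  have l01 : x₀ < x₁ := by linarith
  have l12 : x₁ < x₂ := by linarith
  have l23 : x₂ < x₃ := by linarith
  have g0 : ∀ x ∈ Ico x₀ x₁, HasSecondDerivAt u (-(κ ^ 2 * u x)) x := fun x hx =>
    hu.gap_equation (n - 1) x (by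
      push_cast
      exact ⟨by nlinarith [hx.1, e01], by nlinarith [hx.2]⟩)
  have g1 : ∀ x ∈ Ioc x₂ x₃, HasSecondDerivAt u (-(κ ^ 2 * u x)) x := fun x hx =>
    hu.gap_equation n x ⟨hx.1, by nlinarith [hx.2, e23]⟩
  have hR : ∀ x ∈ Ioo x₁ x₂, HasSecondDerivAt u (-(k ^ 2 * u x)) x := fun x hx =>
    hu.resonator_equation n x hx
  obtain ⟨i, m, him⟩ := exists_position n
  have hleft : leftEnd ℓ s i m = x₁ := by rw [leftEnd_eq, hx₁, him]
  have hright : rightEnd ℓ s i m = x₂ := by rw [rightEnd, leftEnd_eq, hx₂, him]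
  obtain ⟨a, ha, ha'⟩ := hu.flux_left i m
  obtain ⟨b, hb, hb'⟩ := hu.flux_right i m
  rw [hleft] at ha ha'
  rw [hright] at hb hb'
  obtain ⟨A1, A2, -⟩ := transfer_interval l01 hu.continuous.continuousOn
    (fun x hx => g0 x ⟨hx.1.le, hx.2⟩) (g0 x₀ ⟨le_rfl, l01⟩).derivLimRight
  obtain ⟨B1, B2, B3⟩ := transfer_interval l12 hu.continuous.continuousOn hR ha'
  obtain ⟨C1, C2, -⟩ := transfer_interval l23 hu.continuous.continuousOn
    (fun x hx => g1 x ⟨hx.1, hx.2.le⟩) hb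
  have ha2 := tendsto_nhds_unique ha A2
  have hb2 := tendsto_nhds_unique hb' B2
  have hc2 := tendsto_nhds_unique (g1 x₃ ⟨l23, le_rfl⟩).derivLimLeft C2
  have y1 := A1 x₁ ⟨l01.le, le_rfl⟩
  have y2 := B1 x₂ ⟨l12.le, le_rfl⟩
  have y3 := C1 x₃ ⟨l23.le, le_rfl⟩
  rw [e01] at ha2 y1
  rw [e12] at hb2 y2 B3
  rw [e23] at hc2 y3
  have hb3 : b = -(k ^ 2 * sinOver k ℓ / δ) * u x₁ + Complex.cos (k * ℓ) * a := by
    apply mul_left_cancel₀ hδ'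
    rw [hb2]; field_simp
  have hamp : chainAmplitude ℓ s u n
      = (sinOver k ℓ * u x₁ + 2 * sinOver k (ℓ / 2) ^ 2 * (δ * a)) / ℓ := by
    rw [chainAmplitude, B3]; push_cast; ring
  have hdet := halfGap_det s κ
  have hhalf := one_sub_cos_mul k ℓ
  have hsq : sinOver k ℓ ^ 2 = 2 * sinOver k (ℓ / 2) ^ 2 * (1 + Complex.cos (k * ℓ)) := by
    have h1 := sinOver_eq_half k ℓ
    have h2 := cos_sq_add_sinOver_sq k (ℓ / 2)
    rw [h1]
    linear_combination 4 * sinOver k (ℓ / 2) ^ 2 * h2 + 2 * sinOver k (ℓ / 2) ^ 2 * hhalf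
  have hback : sinOver k ℓ * u x₁ + 2 * sinOver k (ℓ / 2) ^ 2 * (δ * a)
      = sinOver k ℓ * u x₂ - 2 * sinOver k (ℓ / 2) ^ 2 * (δ * b) := by
    rw [y2, hb2]
    linear_combination sinOver k ℓ * u x₁ * hhalf - δ * a * hsq
  have y2' : u x₂ = Complex.cos (κ * (s / 2 : ℝ)) * u x₃ - sinOver κ (s / 2) * deriv u x₃ := by
    rw [hc2, y3]; rw [halfGapDown] at hdet
    linear_combination (-u x₂) * hdet
  have hb4 : b = -halfGapDown s κ * u x₃ + Complex.cos (κ * (s / 2 : ℝ)) * deriv u x₃ := by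
    rw [hc2, y3]; rw [halfGapDown] at hdet ⊢
    linear_combination (-b) * hdet
  refine ⟨?_, ?_, ?_, ?_, ?_⟩
  · rw [y3, hb3, y2, y1, ha2, cellDiag, cellUp, halfGapDown]; ring
  · rw [hc2, hb3, y2, y1, ha2, cellDiag, cellDown, halfGapDown]; ring
  · rw [hamp, y1, ha2, meanValueCoeff, meanDerivCoeff, halfGapDown]; ring
  · rw [hamp, hback, y2', hb4, meanValueCoeff, meanDerivCoeff]; ring
  · intro h0 h0' x hx
    have z1 : u x₁ = 0 := by rw [y1, h0, h0']; ring
    have za : a = 0 := by rw [ha2, h0, h0']; ring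
    have z2 : u x₂ = 0 := by rw [y2, z1, za]; ring
    have zb : b = 0 := by rw [hb3, z1, za]; ring
    rcases le_total x x₁ with h | h
    · rw [A1 x ⟨hx.1, h⟩, h0, h0']; ring
    rcases le_total x x₂ with h' | h'
    · rw [B1 x ⟨h, h'⟩, z1, za]; ring
    · rw [C1 x ⟨h', hx.2⟩, z2, zb]; ring

/-- Integrals over part of the gap following its centre. -/
theorem IsLocalisedMode.integral_gap (hu : IsLocalisedMode ℓ s v v₁ v₂ δ ω u)
    (n : ℤ) {t : ℝ} (ht : 0 < t) (hts : t ≤ s / 2) :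
    ∫ x in gapCentre ℓ s n..gapCentre ℓ s n + t, u x =
      sinOver (ω / v) t * u (gapCentre ℓ s n)
        + 2 * sinOver (ω / v) (t / 2) ^ 2 * deriv u (gapCentre ℓ s n) := by
  have g0 : ∀ x ∈ Ico (gapCentre ℓ s n) (gapCentre ℓ s n + t),
      HasSecondDerivAt u (-((ω / v) ^ 2 * u x)) x := fun x hx =>
    hu.gap_equation (n - 1) x (by
      have h1 := hx.1
      have h2 := hx.2
      rw [gapCentre] at h1 h2
      push_cast
      constructor <;> nlinarith)
  have := (transfer_interval (by linarith) hu.continuous.continuousOn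
    (fun x hx => g0 x ⟨hx.1.le, hx.2⟩) (g0 _ ⟨le_rfl, by linarith⟩).derivLimRight).2.2
  simpa using this

end Mode

/-- Integrals of an integrable function over windows of fixed length that escape to infinity tend
to zero. -/
theorem tendsto_window_integral {g : ℝ → ℝ} (hg : Integrable g) {x : ℕ → ℝ}
    (hx : Tendsto (fun n => |x n|) atTop atTop) {t : ℝ} (ht : 0 ≤ t) :
    Tendsto (fun n => ∫ y in x n..x n + t, g y) atTop (𝓝 0) := by
  have h1 : ∀ n, ∫ y in x n..x n + t, g y = ∫ y, (Ioc (x n) (x n + t)).indicator g y := by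
    intro n
    rw [intervalIntegral.integral_of_le (by linarith), integral_indicator measurableSet_Ioc]
  simp only [h1]
  have h2 := tendsto_integral_of_dominated_convergence (F := fun n y =>
    (Ioc (x n) (x n + t)).indicator g y) (f := fun _ => (0 : ℝ)) (μ := volume) (fun y => ‖g y‖)
    (fun n => (hg.indicator measurableSet_Ioc).aestronglyMeasurable) hg.norm
    (fun n => Eventually.of_forall fun y => norm_indicator_le_norm_self _ _)
    (Eventually.of_forall fun y => by
      refine tendsto_const_nhds.congr' ?_
      filter_upwards [hx.eventually_gt_atTop (|y| + t)] with n hn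
      rw [indicator_of_notMem]
      rintro ⟨ha, hb⟩
      rcases abs_cases (x n) with h | h <;> rcases abs_cases y with h' | h' <;> linarith)
  simpa using h2

/-- Integrals of a continuous square-integrable function over windows of fixed length that escape to
infinity tend to zero. -/
theorem tendsto_window_integral_of_memLp {u : ℝ → ℂ} (hc : Continuous u) (hu : MemLp u 2 volume)
    {x : ℕ → ℝ} (hx : Tendsto (fun n => |x n|) atTop atTop) {t : ℝ} (ht : 0 ≤ t) :
    Tendsto (fun n => ∫ y in x n..x n + t, u y) atTop (𝓝 0) := by
  have hg : Integrable fun y => ‖u y‖ ^ 2 :=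
    (memLp_two_iff_integrable_sq_norm hc.aestronglyMeasurable).1 hu
  have h0 := tendsto_window_integral hg hx ht
  rw [tendsto_zero_iff_norm_tendsto_zero]
  rw [Metric.tendsto_atTop]
  intro ε hε
  set η : ℝ := ε / (t + 1) with hη
  have hηpos : 0 < η := by positivity
  have hηt : η * (t + 1) = ε := by rw [hη]; field_simp
  obtain ⟨N, hN⟩ := (Metric.tendsto_atTop.1 h0) (η * ε) (by positivity)
  refine ⟨N, fun n hn => ?_⟩
  have h3 := hN n hn
  rw [Real.dist_eq, sub_zero] at h3
  have h4 := (abs_lt.1 h3).2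
  rw [Real.dist_eq, sub_zero, abs_of_nonneg (norm_nonneg _)]
  have hle : x n ≤ x n + t := by linarith
  have hi1 : IntervalIntegrable (fun y => ‖u y‖ ^ 2) volume (x n) (x n + t) :=
    (hc.norm.pow 2).intervalIntegrable _ _
  calc ‖∫ y in x n..x n + t, u y‖ ≤ ∫ y in x n..x n + t, ‖u y‖ :=
        intervalIntegral.norm_integral_le_integral_norm hle
    _ ≤ ∫ y in x n..x n + t, (η / 2 + 1 / (2 * η) * ‖u y‖ ^ 2) := by
        refine intervalIntegral.integral_mono_on hle (hc.norm.intervalIntegrable _ _)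
          (intervalIntegrable_const.add (hi1.const_mul _)) fun y _ => ?_
        have h5 : η / 2 + 1 / (2 * η) * ‖u y‖ ^ 2 - ‖u y‖ = (‖u y‖ - η) ^ 2 / (2 * η) := by
          field_simp; ring
        have h6 : 0 ≤ (‖u y‖ - η) ^ 2 / (2 * η) := by positivity
        linarith
    _ = η / 2 * t + 1 / (2 * η) * ∫ y in x n..x n + t, ‖u y‖ ^ 2 := by
        rw [intervalIntegral.integral_add intervalIntegrable_const (hi1.const_mul _),
          intervalIntegral.integral_const, intervalIntegral.integral_const_mul]
        simp; ring
    _ < ε := by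
        have h7 : 1 / (2 * η) * ∫ y in x n..x n + t, ‖u y‖ ^ 2 < 1 / (2 * η) * (η * ε) :=
          mul_lt_mul_of_pos_left h4 (by positivity)
        have h8 : 1 / (2 * η) * (η * ε) = ε / 2 := by field_simp
        nlinarith

/-- Determinant of the two functionals that recover value and derivative at the centre of a gap
from integrals over parts of that gap. -/
noncomputable def windowDet (s : ℝ) (κ : ℂ) : ℂ :=
  sinOver κ (s / 4) * (2 * sinOver κ (s / 2 / 2) ^ 2)
    - 2 * sinOver κ (s / 4 / 2) ^ 2 * sinOver κ (s / 2)

section Mode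

variable {ℓ s : ℝ} {v v₁ v₂ : ℂ} {δ : ℝ} {ω : ℂ} {u : ℝ → ℂ}

theorem IsLocalisedMode.tendsto_state (hu : IsLocalisedMode ℓ s v v₁ v₂ δ ω u) (hs : 0 < s)
    (hdet : windowDet s (ω / v) ≠ 0) {n : ℕ → ℤ}
    (hn : Tendsto (fun m => |gapCentre ℓ s (n m)|) atTop atTop) :
    Tendsto (fun m => u (gapCentre ℓ s (n m))) atTop (𝓝 0) ∧
      Tendsto (fun m => deriv u (gapCentre ℓ s (n m))) atTop (𝓝 0) := by
  have h1 := tendsto_window_integral_of_memLp hu.continuous hu.square_integrable hn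
    (t := s / 4) (by positivity)
  have h2 := tendsto_window_integral_of_memLp hu.continuous hu.square_integrable hn
    (t := s / 2) (by positivity)
  simp only [hu.integral_gap (n _) (t := s / 4) (by positivity) (by linarith)] at h1
  simp only [hu.integral_gap (n _) (t := s / 2) (by positivity) le_rfl] at h2
  constructor
  · have h3 := ((h1.mul_const (2 * sinOver (ω / v) (s / 2 / 2) ^ 2)).sub
      (h2.mul_const (2 * sinOver (ω / v) (s / 4 / 2) ^ 2))).div_const (windowDet s (ω / v))
    simp only [zero_mul, sub_zero, zero_div] at h3
    refine h3.congr fun m => ?_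
    rw [div_eq_iff hdet, windowDet]; ring
  · have h3 := ((h2.mul_const (sinOver (ω / v) (s / 4))).sub
      (h1.mul_const (sinOver (ω / v) (s / 2)))).div_const (windowDet s (ω / v))
    simp only [zero_mul, sub_zero, zero_div] at h3
    refine h3.congr fun m => ?_
    rw [div_eq_iff hdet, windowDet]; ring

end Mode

/-- A nontrivial solution of a reflection-symmetric and eventually 2-periodic recursion of
symmetric transfer matrices, that decays in both directions, is even or odd, and geometric on either
side. -/
theorem exists_decay_factor {y w c f g : ℤ → ℂ} {c₁ f₁ g₁ c₂ f₂ g₂ : ℂ}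
    (hy : ∀ n, y (n + 1) = c n * y n + f n * w n) (hw : ∀ n, w (n + 1) = g n * y n + c n * w n)
    (hdet : ∀ n, c n ^ 2 - f n * g n = 1)
    (hsymm : ∀ n, c (3 - n) = c n ∧ f (3 - n) = f n ∧ g (3 - n) = g n)
    (heven : ∀ m : ℕ, c (2 + 2 * m) = c₂ ∧ f (2 + 2 * m) = f₂ ∧ g (2 + 2 * m) = g₂)
    (hodd : ∀ m : ℕ, c (3 + 2 * m) = c₁ ∧ f (3 + 2 * m) = f₁ ∧ g (3 + 2 * m) = g₁)
    (hy0 : Tendsto (fun m : ℕ => y (2 + m)) atTop (𝓝 0))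
    (hw0 : Tendsto (fun m : ℕ => w (2 + m)) atTop (𝓝 0))
    (hy0' : Tendsto (fun m : ℕ => y (2 - m)) atTop (𝓝 0))
    (hw0' : Tendsto (fun m : ℕ => w (2 - m)) atTop (𝓝 0))
    (hne : y 2 ≠ 0 ∨ w 2 ≠ 0) :
    ∃ γ q : ℂ, ‖q‖ < 1 ∧
      (∀ m : ℕ, y (2 + 2 * m) = q ^ m * y 2 ∧ w (2 + 2 * m) = q ^ m * w 2) ∧
      (∀ m : ℕ, y (2 - m) = γ * y (2 + m) ∧ w (2 - m) = -γ * w (2 + m)) ∧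
      ((γ = 1 ∧ w 2 = 0 ∧ y 2 ≠ 0 ∧ g₁ * c₂ + c₁ * g₂ = 0 ∧ q = c₁ * c₂ + f₁ * g₂) ∨
        (γ = -1 ∧ y 2 = 0 ∧ w 2 ≠ 0 ∧ c₁ * f₂ + f₁ * c₂ = 0 ∧ q = c₁ * c₂ + g₁ * f₂)) := by
  -- backward recursion, reflected
  have hback : ∀ m : ℕ, y (2 - (m + 1 : ℕ)) = c (2 + m) * y (2 - m) - f (2 + m) * w (2 - m) ∧
      w (2 - (m + 1 : ℕ)) = -g (2 + m) * y (2 - m) + c (2 + m) * w (2 - m) := by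
    intro m
    have h1 := hy (1 - m)
    have h2 := hw (1 - m)
    have h3 := hdet (1 - m)
    have h4 := hsymm (2 + m)
    rw [show (3 : ℤ) - (2 + m) = 1 - m by ring] at h4
    rw [show (1 : ℤ) - m + 1 = 2 - m by ring] at h1 h2
    rw [← h4.1, ← h4.2.1, ← h4.2.2, h1, h2,
      show (2 : ℤ) - (m + 1 : ℕ) = 1 - m by push_cast; ring]
    constructor
    · linear_combination (-y (1 - m)) * h3
    · linear_combination (-w (1 - m)) * h3
  have hfwd : ∀ m : ℕ, y (2 + (m + 1 : ℕ)) = c (2 + m) * y (2 + m) + f (2 + m) * w (2 + m) ∧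
      w (2 + (m + 1 : ℕ)) = g (2 + m) * y (2 + m) + c (2 + m) * w (2 + m) := by
    intro m
    rw [show (2 : ℤ) + (m + 1 : ℕ) = 2 + m + 1 by push_cast; ring]
    exact ⟨hy _, hw _⟩
  -- Wronskian with the reflected solution
  have hW : ∀ m : ℕ, y (2 + m) * w (2 - m) + w (2 + m) * y (2 - m) = 2 * y 2 * w 2 := by
    intro m
    induction m with
    | zero => simp; ring
    | succ m ih =>
      rw [(hback m).1, (hback m).2, (hfwd m).1, (hfwd m).2, ← ih]
      linear_combination (y (2 + m) * w (2 - m) + w (2 + m) * y (2 - m)) * hdet (2 + m)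
  have hyw : y 2 * w 2 = 0 := by
    have h1 := (hy0.mul hw0').add (hw0.mul hy0')
    simp only [hW, mul_zero, add_zero] at h1
    have h2 := tendsto_nhds_unique h1 tendsto_const_nhds
    have : 2 * (y 2 * w 2) = 0 := by rw [← mul_assoc, ← h2]
    simpa using this
  -- transfer over a period
  have hper : ∀ m : ℕ,
      y (2 + 2 * (m + 1 : ℕ)) = (c₁ * c₂ + f₁ * g₂) * y (2 + 2 * m)
        + (c₁ * f₂ + f₁ * c₂) * w (2 + 2 * m) ∧
      w (2 + 2 * (m + 1 : ℕ)) = (g₁ * c₂ + c₁ * g₂) * y (2 + 2 * m)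
        + (c₁ * c₂ + g₁ * f₂) * w (2 + 2 * m) := by
    intro m
    have a1 := hy (2 + 2 * m)
    have a2 := hw (2 + 2 * m)
    rw [(heven m).1, (heven m).2.1, show (2 : ℤ) + 2 * m + 1 = 3 + 2 * m by ring] at a1
    rw [(heven m).1, (heven m).2.2, show (2 : ℤ) + 2 * m + 1 = 3 + 2 * m by ring] at a2
    have b1 := hy (3 + 2 * m)
    have b2 := hw (3 + 2 * m)
    rw [(hodd m).1, (hodd m).2.1, a1, a2] at b1
    rw [(hodd m).1, (hodd m).2.2, a1, a2] at b2
    rw [show (2 : ℤ) + 2 * (m + 1 : ℕ) = 3 + 2 * m + 1 by push_cast; ring, b1, b2]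
    constructor <;> ring
  have hdetT : (c₁ * c₂ + f₁ * g₂) * (c₁ * c₂ + g₁ * f₂)
      - (c₁ * f₂ + f₁ * c₂) * (g₁ * c₂ + c₁ * g₂) = 1 := by
    have d1 := hdet (3 + 2 * (0 : ℕ))
    have d2 := hdet (2 + 2 * (0 : ℕ))
    rw [(hodd 0).1, (hodd 0).2.1, (hodd 0).2.2] at d1
    rw [(heven 0).1, (heven 0).2.1, (heven 0).2.2] at d2
    linear_combination d2 * (c₁ ^ 2 - f₁ * g₁) + d1
  have hsub : Tendsto (fun m : ℕ => 2 * m) atTop atTop :=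
    tendsto_id.const_mul_atTop' (by norm_num)
  have hy2 : Tendsto (fun m : ℕ => y (2 + 2 * m)) atTop (𝓝 0) := by
    simpa [Function.comp_def] using hy0.comp hsub
  have hw2 : Tendsto (fun m : ℕ => w (2 + 2 * m)) atTop (𝓝 0) := by
    simpa [Function.comp_def] using hw0.comp hsub
  -- Wronskian with the shifted solution
  have hV : ∀ m : ℕ, y (2 + 2 * m) * w (2 + 2 * (m + 1 : ℕ))
      - w (2 + 2 * m) * y (2 + 2 * (m + 1 : ℕ)) = y 2 * ((g₁ * c₂ + c₁ * g₂) * y 2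
        + (c₁ * c₂ + g₁ * f₂) * w 2) - w 2 * ((c₁ * c₂ + f₁ * g₂) * y 2
        + (c₁ * f₂ + f₁ * c₂) * w 2) := by
    intro m
    induction m with
    | zero =>
      rw [(hper 0).1, (hper 0).2]; simp
    | succ m ih =>
      rw [← ih, (hper (m + 1)).1, (hper (m + 1)).2]
      rw [(hper m).1, (hper m).2]
      generalize c₁ * c₂ + f₁ * g₂ = A at *
      generalize c₁ * c₂ + g₁ * f₂ = D at *
      generalize c₁ * f₂ + f₁ * c₂ = B at *
      generalize g₁ * c₂ + c₁ * g₂ = E at *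
      generalize y (2 + 2 * m) = Y
      generalize w (2 + 2 * m) = W
      linear_combination (Y * (E * Y + D * W) - W * (A * Y + B * W)) * hdetT
  have hV0 : y 2 * ((g₁ * c₂ + c₁ * g₂) * y 2 + (c₁ * c₂ + g₁ * f₂) * w 2)
      - w 2 * ((c₁ * c₂ + f₁ * g₂) * y 2 + (c₁ * f₂ + f₁ * c₂) * w 2) = 0 := by
    have h1 := (hy2.mul (hw2.comp (tendsto_add_atTop_nat 1))).sub
      (hw2.mul (hy2.comp (tendsto_add_atTop_nat 1)))
    simp only [Function.comp_def, hV, mul_zero, sub_zero] at h1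
    exact tendsto_nhds_unique tendsto_const_nhds h1
  have hnorm : ∀ {q a : ℂ}, a ≠ 0 → Tendsto (fun m : ℕ => q ^ m * a) atTop (𝓝 0) → ‖q‖ < 1 := by
    intro q a ha h
    have h1 := h.mul_const a⁻¹
    simp only [mul_assoc, mul_inv_cancel₀ ha, mul_one, zero_mul] at h1
    exact (tendsto_pow_atTop_nhds_zero_iff_norm_lt_one).1 h1
  rcases mul_eq_zero.1 hyw with h0 | h0
  · -- odd
    have hw2' : w 2 ≠ 0 := by simpa [h0] using hne
    have hB : c₁ * f₂ + f₁ * c₂ = 0 := by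
      simpa [h0, hw2'] using hV0
    have hpow : ∀ m : ℕ, y (2 + 2 * m) = (c₁ * c₂ + g₁ * f₂) ^ m * y 2 ∧
        w (2 + 2 * m) = (c₁ * c₂ + g₁ * f₂) ^ m * w 2 := by
      intro m
      induction m with
      | zero => simp
      | succ m ih =>
        rw [(hper m).1, (hper m).2, ih.1, ih.2, h0, hB]
        constructor <;> ring
    refine ⟨-1, c₁ * c₂ + g₁ * f₂, hnorm hw2' (hw2.congr fun m => (hpow m).2), hpow, ?_,
      Or.inr ⟨rfl, h0, hw2', hB, rfl⟩⟩
    intro m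
    induction m with
    | zero => simp [h0]
    | succ m ih =>
      rw [(hback m).1, (hback m).2, (hfwd m).1, (hfwd m).2, ih.1, ih.2]
      constructor <;> ring
  · -- even
    have hy2' : y 2 ≠ 0 := by simpa [h0] using hne
    have hB : g₁ * c₂ + c₁ * g₂ = 0 := by
      simpa [h0, hy2'] using hV0
    have hpow : ∀ m : ℕ, y (2 + 2 * m) = (c₁ * c₂ + f₁ * g₂) ^ m * y 2 ∧
        w (2 + 2 * m) = (c₁ * c₂ + f₁ * g₂) ^ m * w 2 := by
      intro m
      induction m with
      | zero => simp
      | succ m ih =>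
        rw [(hper m).1, (hper m).2, ih.1, ih.2, h0, hB]
        constructor <;> ring
    refine ⟨1, c₁ * c₂ + f₁ * g₂, hnorm hy2' (hy2.congr fun m => (hpow m).1), hpow, ?_,
      Or.inl ⟨rfl, h0, hy2', hB, rfl⟩⟩
    intro m
    induction m with
    | zero => simp [h0]
    | succ m ih =>
      rw [(hback m).1, (hback m).2, (hfwd m).1, (hfwd m).2, ih.1, ih.2]
      constructor <;> ring

section Mode

variable {ℓ s : ℝ} {v v₁ v₂ : ℂ} {δ : ℝ} {ω : ℂ} {u : ℝ → ℂ}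

theorem isDecayRatio_of_geometric {γ q b : ℂ} (hq : ‖q‖ < 1)
    (heven : ∀ m : ℕ, chainAmplitude ℓ s u (2 + 2 * m) = q ^ m * chainAmplitude ℓ s u 2)
    (hodd : ∀ m : ℕ, chainAmplitude ℓ s u (3 + 2 * m) = q ^ m * chainAmplitude ℓ s u 3)
    (hrefl : ∀ m : ℕ, chainAmplitude ℓ s u (1 - m) = γ * chainAmplitude ℓ s u (2 + m))
    (hb : chainAmplitude ℓ s u 3 = b * chainAmplitude ℓ s u 2) :
    IsDecayRatio ℓ s u b := by
  have e0 : ∀ m : ℕ, chainAmplitude ℓ s u (-(2 * m)) = γ * (q ^ m * chainAmplitude ℓ s u 3) := by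
    intro m
    rw [← hodd]
    have := hrefl (2 * m + 1)
    push_cast at this
    rw [show (1 : ℤ) - (2 * m + 1) = -(2 * m) by ring,
      show (2 : ℤ) + (2 * m + 1) = 3 + 2 * m by ring] at this
    exact this
  have e1 : ∀ m : ℕ, chainAmplitude ℓ s u (1 - 2 * m) = γ * (q ^ m * chainAmplitude ℓ s u 2) := by
    intro m
    rw [← heven]
    have := hrefl (2 * m)
    push_cast at this
    exact this
  have hgeo : ∀ a : ℂ, Summable fun m : ℕ => ‖q ^ m * a‖ := fun a => by
    simp only [norm_mul, norm_pow]
    exact (summable_geometric_of_lt_one (norm_nonneg q) hq).mul_right _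
  have hgeo' : ∀ a : ℂ, Summable fun m : ℕ => ‖γ * (q ^ m * a)‖ := fun a => by
    simp only [norm_mul γ]
    exact (hgeo a).mul_left _
  have r0 : ∀ m : ℕ, amplitude ℓ s u 0 (m + 1 : ℕ) = q ^ m * chainAmplitude ℓ s u 2 := by
    intro m
    rw [amplitude_eq, ← heven]; congr 1; simp; ring
  have r1 : ∀ m : ℕ, amplitude ℓ s u 1 (m + 1 : ℕ) = q ^ m * chainAmplitude ℓ s u 3 := by
    intro m
    rw [amplitude_eq, ← hodd]; congr 1; simp; ring
  have l0 : ∀ m : ℕ, amplitude ℓ s u 0 (-m) = γ * (q ^ m * chainAmplitude ℓ s u 3) := by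
    intro m
    rw [amplitude_eq, ← e0]; congr 1; simp
  have l1 : ∀ m : ℕ, amplitude ℓ s u 1 (-m) = γ * (q ^ m * chainAmplitude ℓ s u 2) := by
    intro m
    rw [amplitude_eq, ← e1]; congr 1; simp; ring
  refine ⟨fun i => ?_, fun α => ⟨?_, ?_⟩⟩
  · fin_cases i
    · refine Summable.of_nat_of_neg ((summable_nat_add_iff 1).1 ?_) ?_
      · simpa only [Fin.zero_eta, r0] using hgeo _
      · simpa only [Fin.zero_eta, l0] using hgeo' _
    · refine Summable.of_nat_of_neg ((summable_nat_add_iff 1).1 ?_) ?_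
      · simpa only [Fin.mk_one, r1] using hgeo _
      · simpa only [Fin.mk_one, l1] using hgeo' _
  · rw [leftSum, leftSum, ← tsum_mul_left]
    refine tsum_congr fun ⟨m, hm⟩ => ?_
    obtain ⟨j, rfl⟩ : ∃ j : ℕ, m = -(j : ℤ) := ⟨m.natAbs, by omega⟩
    simp only [l0, l1, hb]; ring
  · rw [rightSum, rightSum, ← tsum_mul_left]
    refine tsum_congr fun ⟨m, hm⟩ => ?_
    obtain ⟨j, rfl⟩ : ∃ j : ℕ, m = ((j + 1 : ℕ) : ℤ) := ⟨m.natAbs - 1, by omega⟩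
    simp only [r0, r1, hb]; ring

theorem tendsto_abs_gapCentre_add (hℓ : 0 < ℓ) (hs : 0 < s) :
    Tendsto (fun m : ℕ => |gapCentre ℓ s (2 + m)|) atTop atTop := by
  have h : Tendsto (fun m : ℕ => (m : ℝ) * (ℓ + s) + (2 * (ℓ + s) - s / 2)) atTop atTop :=
    tendsto_atTop_add_const_right _ _
      (tendsto_natCast_atTop_atTop.atTop_mul_const (by positivity))
  refine (tendsto_abs_atTop_atTop.comp h).congr fun m => ?_
  simp only [Function.comp, gapCentre]; congr 1; push_cast; ring

theorem tendsto_abs_gapCentre_sub (hℓ : 0 < ℓ) (hs : 0 < s) :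
    Tendsto (fun m : ℕ => |gapCentre ℓ s (2 - m)|) atTop atTop := by
  have h : Tendsto (fun m : ℕ => (m : ℝ) * (ℓ + s) + (s / 2 - 2 * (ℓ + s))) atTop atTop :=
    tendsto_atTop_add_const_right _ _
      (tendsto_natCast_atTop_atTop.atTop_mul_const (by positivity))
  refine (tendsto_abs_atTop_atTop.comp h).congr fun m => ?_
  simp only [Function.comp, gapCentre]; rw [← abs_neg]; congr 1; push_cast; ring

theorem IsLocalisedMode.state_ne_zero (hu : IsLocalisedMode ℓ s v v₁ v₂ δ ω u) (hℓ : 0 < ℓ)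
    (hs : 0 < s) (hδ : δ ≠ 0) :
    u (gapCentre ℓ s 2) ≠ 0 ∨ deriv u (gapCentre ℓ s 2) ≠ 0 := by
  by_contra! h
  have hall : ∀ n : ℤ, u (gapCentre ℓ s n) = 0 ∧ deriv u (gapCentre ℓ s n) = 0 := by
    intro n
    induction n using Int.inductionOn' with
    | b => exact 2
    | zero => exact h
    | succ n _ ih =>
      obtain ⟨h1, h2, -⟩ := hu.transfer_cell hℓ hs hδ n
      rw [h1, h2, ih.1, ih.2]; simp
    | pred n _ ih =>
      obtain ⟨h1, h2, -⟩ := hu.transfer_cell hℓ hs hδ (n - 1)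
      rw [sub_add_cancel, ih.1] at h1
      rw [sub_add_cancel, ih.2] at h2
      have hd := cell_det ℓ s (ω / v) (ω / chainSpeed v₁ v₂ (n - 1)) hδ
      constructor
      · linear_combination (-u (gapCentre ℓ s (n - 1))) * hd
          - cellDiag ℓ s (ω / v) (ω / chainSpeed v₁ v₂ (n - 1)) δ * h1
          + cellUp ℓ s (ω / v) (ω / chainSpeed v₁ v₂ (n - 1)) δ * h2
      · linear_combination (-deriv u (gapCentre ℓ s (n - 1))) * hd
          - cellDiag ℓ s (ω / v) (ω / chainSpeed v₁ v₂ (n - 1)) δ * h2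
          + cellDown ℓ s (ω / v) (ω / chainSpeed v₁ v₂ (n - 1)) δ * h1
  refine hu.nontrivial (funext fun x => ?_)
  have hh : 0 < ℓ + s := by positivity
  have h1 := (le_div_iff₀ hh).1 (Int.floor_le ((x + s / 2) / (ℓ + s)))
  have h2 := (div_lt_iff₀ hh).1 (Int.lt_floor_add_one ((x + s / 2) / (ℓ + s)))
  refine (hu.transfer_cell hℓ hs hδ ⌊(x + s / 2) / (ℓ + s)⌋).2.2.2.2 (hall _).1 (hall _).2 x ?_
  constructor
  · rw [gapCentre]; linarith
  · rw [gapCentre]; push_cast; linarith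

/-- Exact dispersion relation, decay and decay ratio of a mode that is even with respect to the
centre of the defect. -/
def HasEvenDispersion (ℓ s : ℝ) (v v₁ v₂ : ℂ) (δ : ℝ) (ω : ℂ) (u : ℝ → ℂ) : Prop :=
  cellDown ℓ s (ω / v) (ω / v₁) δ * cellDiag ℓ s (ω / v) (ω / v₂) δ
      + cellDiag ℓ s (ω / v) (ω / v₁) δ * cellDown ℓ s (ω / v) (ω / v₂) δ = 0 ∧
    ‖cellDiag ℓ s (ω / v) (ω / v₁) δ * cellDiag ℓ s (ω / v) (ω / v₂) δ
      + cellUp ℓ s (ω / v) (ω / v₁) δ * cellDown ℓ s (ω / v) (ω / v₂) δ‖ < 1 ∧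
    (meanValueCoeff ℓ s (ω / v) (ω / v₂) δ ≠ 0 → IsDecayRatio ℓ s u
      ((meanValueCoeff ℓ s (ω / v) (ω / v₁) δ * cellDiag ℓ s (ω / v) (ω / v₂) δ
      + meanDerivCoeff ℓ s (ω / v) (ω / v₁) δ * cellDown ℓ s (ω / v) (ω / v₂) δ)
      / meanValueCoeff ℓ s (ω / v) (ω / v₂) δ))

/-- Exact dispersion relation, decay and decay ratio of a mode that is odd with respect to the
centre of the defect. -/
def HasOddDispersion (ℓ s : ℝ) (v v₁ v₂ : ℂ) (δ : ℝ) (ω : ℂ) (u : ℝ → ℂ) : Prop :=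
  cellDiag ℓ s (ω / v) (ω / v₁) δ * cellUp ℓ s (ω / v) (ω / v₂) δ
      + cellUp ℓ s (ω / v) (ω / v₁) δ * cellDiag ℓ s (ω / v) (ω / v₂) δ = 0 ∧
    ‖cellDiag ℓ s (ω / v) (ω / v₁) δ * cellDiag ℓ s (ω / v) (ω / v₂) δ
      + cellDown ℓ s (ω / v) (ω / v₁) δ * cellUp ℓ s (ω / v) (ω / v₂) δ‖ < 1 ∧
    (meanDerivCoeff ℓ s (ω / v) (ω / v₂) δ ≠ 0 → IsDecayRatio ℓ s u
      ((meanValueCoeff ℓ s (ω / v) (ω / v₁) δ * cellUp ℓ s (ω / v) (ω / v₂) δ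
      + meanDerivCoeff ℓ s (ω / v) (ω / v₁) δ * cellDiag ℓ s (ω / v) (ω / v₂) δ)
      / meanDerivCoeff ℓ s (ω / v) (ω / v₂) δ))

/-- A localised mode is even or odd with respect to the centre of the defect, which gives an exact
dispersion relation, and its amplitudes are geometric on either side. -/
theorem IsLocalisedMode.exists_parity (hu : IsLocalisedMode ℓ s v v₁ v₂ δ ω u) (hℓ : 0 < ℓ)
    (hs : 0 < s) (hδ : δ ≠ 0) (hwin : windowDet s (ω / v) ≠ 0) :
    HasEvenDispersion ℓ s v v₁ v₂ δ ω u ∨ HasOddDispersion ℓ s v v₁ v₂ δ ω u := by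
  have htr := hu.transfer_cell hℓ hs hδ
  have hfwd := hu.tendsto_state hs hwin (tendsto_abs_gapCentre_add hℓ hs)
  have hbwd := hu.tendsto_state hs hwin (tendsto_abs_gapCentre_sub hℓ hs)
  obtain ⟨γ, q, hq, hpow, hrefl, hcase⟩ := exists_decay_factor
    (y := fun n => u (gapCentre ℓ s n)) (w := fun n => deriv u (gapCentre ℓ s n))
    (c := fun n => cellDiag ℓ s (ω / v) (ω / chainSpeed v₁ v₂ n) δ)
    (f := fun n => cellUp ℓ s (ω / v) (ω / chainSpeed v₁ v₂ n) δ)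
    (g := fun n => cellDown ℓ s (ω / v) (ω / chainSpeed v₁ v₂ n) δ)
    (fun n => (htr n).1) (fun n => (htr n).2.1) (fun n => cell_det _ _ _ _ hδ)
    (fun n => by simp only [chainSpeed_reflect, and_self])
    (fun m => by simp only [chainSpeed_even]; exact ⟨rfl, rfl, rfl⟩)
    (fun m => by simp only [chainSpeed_odd]; exact ⟨rfl, rfl, rfl⟩)
    hfwd.1 hfwd.2 hbwd.1 hbwd.2 (hu.state_ne_zero hℓ hs hδ)
  have hpow3 : ∀ m : ℕ, u (gapCentre ℓ s (3 + 2 * m)) = q ^ m * u (gapCentre ℓ s 3) ∧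
      deriv u (gapCentre ℓ s (3 + 2 * m)) = q ^ m * deriv u (gapCentre ℓ s 3) := by
    intro m
    have h1 := htr (2 + 2 * m)
    have h2 := htr 2
    have h3 := chainSpeed_even (v₁ := v₁) (v₂ := v₂) 0
    simp only [Nat.cast_zero, mul_zero, add_zero] at h3
    rw [chainSpeed_even, show (2 : ℤ) + 2 * m + 1 = 3 + 2 * m by ring] at h1
    rw [h3, show (2 : ℤ) + 1 = 3 by ring] at h2
    rw [h1.1, h1.2.1, h2.1, h2.2.1, (hpow m).1, (hpow m).2]
    constructor <;> ring
  have ha2 : ∀ m : ℕ, chainAmplitude ℓ s u (2 + 2 * m) = q ^ m *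
      (meanValueCoeff ℓ s (ω / v) (ω / v₂) δ * u (gapCentre ℓ s 2)
        + meanDerivCoeff ℓ s (ω / v) (ω / v₂) δ * deriv u (gapCentre ℓ s 2)) := by
    intro m
    rw [(htr _).2.2.1, chainSpeed_even, (hpow m).1, (hpow m).2]; ring
  have ha3 : ∀ m : ℕ, chainAmplitude ℓ s u (3 + 2 * m) = q ^ m *
      (meanValueCoeff ℓ s (ω / v) (ω / v₁) δ * u (gapCentre ℓ s 3)
        + meanDerivCoeff ℓ s (ω / v) (ω / v₁) δ * deriv u (gapCentre ℓ s 3)) := by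
    intro m
    rw [(htr _).2.2.1, chainSpeed_odd, (hpow3 m).1, (hpow3 m).2]; ring
  have ha2' := ha2 0
  have ha3' := ha3 0
  simp only [Nat.cast_zero, mul_zero, add_zero, pow_zero, one_mul] at ha2' ha3'
  have hsp := chainSpeed_even (v₁ := v₁) (v₂ := v₂) 0
  simp only [Nat.cast_zero, mul_zero, add_zero] at hsp
  have ht2 := htr 2
  rw [hsp, show (2 : ℤ) + 1 = 3 by ring] at ht2
  have hamp : ∀ m : ℕ, chainAmplitude ℓ s u (1 - m) = γ * chainAmplitude ℓ s u (2 + m) := by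
    intro m
    have h1 := (htr (1 - m)).2.2.2.1
    have h2 := chainSpeed_reflect v₁ v₂ (2 + m)
    rw [show (3 : ℤ) - (2 + m) = 1 - m by ring] at h2
    rw [show (1 : ℤ) - m + 1 = 2 - m by ring, (hrefl m).1, (hrefl m).2, h2] at h1
    rw [h1, (htr (2 + m)).2.2.1]; ring
  have hratio : ∀ b : ℂ, chainAmplitude ℓ s u 3 = b * chainAmplitude ℓ s u 2 →
      IsDecayRatio ℓ s u b := fun b hb =>
    isDecayRatio_of_geometric hq (fun m => by rw [ha2, ha2']) (fun m => by rw [ha3, ha3'])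
      hamp hb
  rcases hcase with ⟨-, h0, -, hT, hq'⟩ | ⟨-, h0, -, hT, hq'⟩
  · refine Or.inl ⟨hT, hq' ▸ hq, fun hP => hratio _ ?_⟩
    rw [ha2', ha3', ht2.1, ht2.2.1, h0]
    field_simp
    ring
  · refine Or.inr ⟨hT, hq' ▸ hq, fun hP => hratio _ ?_⟩
    rw [ha2', ha3', ht2.1, ht2.2.1, h0]
    field_simp
    ring

/-- The two wave speeds of a chain with a localised mode have different squares. -/
theorem IsLocalisedMode.sq_ne_sq (hu : IsLocalisedMode ℓ s v v₁ v₂ δ ω u) (hℓ : 0 < ℓ)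
    (hs : 0 < s) (hδ : δ ≠ 0) (hwin : windowDet s (ω / v) ≠ 0) : v₁ ^ 2 ≠ v₂ ^ 2 := by
  intro h
  have hdet := cell_det ℓ s (ω / v) (ω / v₂) hδ
  have key : cellDiag ℓ s (ω / v) (ω / v₁) δ = cellDiag ℓ s (ω / v) (ω / v₂) δ ∧
      cellUp ℓ s (ω / v) (ω / v₁) δ = cellUp ℓ s (ω / v) (ω / v₂) δ ∧
      cellDown ℓ s (ω / v) (ω / v₁) δ = cellDown ℓ s (ω / v) (ω / v₂) δ := by
    rcases sq_eq_sq_iff_eq_or_eq_neg.1 h with rfl | rfl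
    · simp
    · simp only [div_neg, cellDiag_neg, cellUp_neg, cellDown_neg, and_self]
  have hnot : ∀ {c f g : ℂ}, c ^ 2 - f * g = 1 → c * f + f * c = 0 → ¬ ‖c * c + f * g‖ < 1 := by
    intro c f g h1 h2 h3
    have h4 : c * f = 0 := by linear_combination h2 / 2
    rcases mul_eq_zero.1 h4 with h5 | h5
    · have : c * c + f * g = -1 := by rw [h5] at h1 ⊢; linear_combination -h1
      rw [this] at h3; simp at h3
    · have : c * c + f * g = 1 := by rw [h5] at h1 ⊢; linear_combination h1
      rw [this] at h3; simp at h3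
  rcases hu.exists_parity hℓ hs hδ hwin with ⟨h1, h2, -⟩ | ⟨h1, h2, -⟩
  · rw [key.1, key.2.2] at h1
    rw [key.1, key.2.1] at h2
    refine hnot (c := cellDiag ℓ s (ω / v) (ω / v₂) δ)
      (f := cellDown ℓ s (ω / v) (ω / v₂) δ) (g := cellUp ℓ s (ω / v) (ω / v₂) δ)
      (by linear_combination hdet) (by linear_combination h1) ?_
    rwa [mul_comm (cellDown _ _ _ _ _)]
  · rw [key.1, key.2.1] at h1
    rw [key.1, key.2.2] at h2
    refine hnot hdet (by linear_combination h1) ?_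
    rwa [mul_comm (cellUp _ _ _ _ _)]

/-- The frequency of a localised mode does not vanish. -/
theorem IsLocalisedMode.frequency_ne_zero (hu : IsLocalisedMode ℓ s v v₁ v₂ δ ω u) (hℓ : 0 < ℓ)
    (hs : 0 < s) (hδ : 0 < δ) (hwin : windowDet s (ω / v) ≠ 0) : ω ≠ 0 := by
  rintro rfl
  have hpos : 0 < s + δ * ℓ := by positivity
  rcases hu.exists_parity hℓ hs hδ.ne' hwin with ⟨h1, h2, -⟩ | ⟨h1, h2, -⟩
  · simp [cellDiag, cellDown, cellUp, halfGapDown] at h2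
  · simp [cellDiag, cellUp, halfGapDown] at h1
    have h3 : ((2 * (s + δ * ℓ) : ℝ) : ℂ) = 0 := by push_cast; linear_combination 2 * h1
    have h4 : 2 * (s + δ * ℓ) = 0 := by exact_mod_cast h3
    linarith

end Mode

/-- Low-frequency, high-contrast asymptotics of the transfer matrix of a cell, as a function of
`ℓ ω² / δ`. -/
theorem cell_asymptotics {ℓ s : ℝ} (hℓ : 0 < ℓ) {v c : ℂ} (hv : v ≠ 0) (hc : c ≠ 0)
    {l : Filter ℝ} {ω : ℝ → ℂ} (hl : Tendsto (fun δ : ℝ => δ) l (𝓝 0)) (hω : Tendsto ω l (𝓝 0)) :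
    ∃ A B F H G : ℝ → ℂ,
      (∀ δ : ℝ, δ ≠ 0 →
        cellDiag ℓ s (ω δ / v) (ω δ / c) δ = A δ + B δ * (ℓ * ω δ ^ 2 / δ) ∧
        cellUp ℓ s (ω δ / v) (ω δ / c) δ = F δ + H δ * (ℓ * ω δ ^ 2 / δ) ∧
        cellDown ℓ s (ω δ / v) (ω δ / c) δ = G δ * (ℓ * ω δ ^ 2 / δ)) ∧
      Tendsto A l (𝓝 1) ∧ Tendsto B l (𝓝 (-(s / (2 * c ^ 2)))) ∧
      Tendsto F l (𝓝 s) ∧ Tendsto H l (𝓝 (-(s ^ 2 / (4 * c ^ 2)))) ∧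
      Tendsto G l (𝓝 (-(1 / c ^ 2))) := by
  have hℓ' : (ℓ : ℂ) ≠ 0 := by exact_mod_cast hℓ.ne'
  have hκ : Tendsto (fun δ => ω δ / v) l (𝓝 0) := by simpa using hω.div_const v
  have hk : Tendsto (fun δ => ω δ / c) l (𝓝 0) := by simpa using hω.div_const c
  have hd : Tendsto (fun δ : ℝ => (δ : ℂ)) l (𝓝 0) := by
    simpa [Function.comp_def] using (Complex.continuous_ofReal.tendsto 0).comp hl
  have tC := tendsto_cos_mul hk ℓ
  have tσ := tendsto_sinOver hk ℓ
  have tp := tendsto_cos_mul hκ (s / 2)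
  have tq := tendsto_sinOver hκ (s / 2)
  have tr : Tendsto (fun δ => halfGapDown s (ω δ / v)) l (𝓝 0) := by
    simpa [halfGapDown] using ((hκ.pow 2).mul tq).neg
  set C := fun δ => Complex.cos (ω δ / c * ℓ)
  set σ := fun δ => sinOver (ω δ / c) ℓ
  set p := fun δ => Complex.cos (ω δ / v * (s / 2 : ℝ))
  set q := fun δ => sinOver (ω δ / v) (s / 2)
  set r := fun δ => halfGapDown s (ω δ / v)
  refine ⟨fun δ => C δ * (p δ ^ 2 + q δ * r δ) + δ * σ δ * p δ * r δ,
    fun δ => -(σ δ / (ℓ * c ^ 2) * p δ * q δ),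
    fun δ => 2 * C δ * p δ * q δ + δ * σ δ * p δ ^ 2,
    fun δ => -(σ δ / (ℓ * c ^ 2) * q δ ^ 2),
    fun δ => -(δ / ℓ * (q δ / v ^ 2) * (2 * C δ * p δ + δ * σ δ * r δ))
      - σ δ / (ℓ * c ^ 2) * p δ ^ 2, ?_, ?_, ?_, ?_, ?_, ?_⟩
  · intro δ hδ
    have hδ' : (δ : ℂ) ≠ 0 := by exact_mod_cast hδ
    refine ⟨?_, ?_, ?_⟩
    · simp only [cellDiag, C, σ, p, q, r]; field_simp; ring
    · simp only [cellUp, C, σ, p, q]; field_simp; ring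
    · have h1 : cellDown ℓ s (ω δ / v) (ω δ / c) δ = (2 * C δ * p δ + δ * σ δ * r δ) * r δ
          - (ω δ / c) ^ 2 * σ δ / δ * p δ ^ 2 := by
        simp only [cellDown, C, σ, p, r]; ring
      have h2 : r δ = -((ω δ / v) ^ 2 * q δ) := rfl
      rw [h1]
      nth_rewrite 2 [h2]
      field_simp
  · simpa using (tC.mul ((tp.pow 2).add (tq.mul tr))).add (((hd.mul tσ).mul tp).mul tr)
  · have := (((tσ.div_const (ℓ * c ^ 2)).mul tp).mul tq).neg
    convert this using 2
    push_cast; field_simp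
  · have := (((tC.const_mul 2).mul tp).mul tq).add ((hd.mul tσ).mul (tp.pow 2))
    convert this using 2
    push_cast; ring
  · have := ((tσ.div_const (ℓ * c ^ 2)).mul (tq.pow 2)).neg
    convert this using 2
    push_cast; field_simp; norm_num
  · have := ((((hd.div_const (ℓ : ℂ)).mul (tq.div_const (v ^ 2))).mul
      (((tC.const_mul 2).mul tp).add ((hd.mul tσ).mul tr))).neg).sub
      ((tσ.div_const (ℓ * c ^ 2)).mul (tp.pow 2))
    convert this using 2
    field_simp; simp

theorem mean_asymptotics {ℓ s : ℝ} (hℓ : 0 < ℓ) {v c : ℂ}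
    {l : Filter ℝ} {ω : ℝ → ℂ} (hl : Tendsto (fun δ : ℝ => δ) l (𝓝 0)) (hω : Tendsto ω l (𝓝 0)) :
    Tendsto (fun δ => meanValueCoeff ℓ s (ω δ / v) (ω δ / c) δ) l (𝓝 1) ∧
      Tendsto (fun δ => meanDerivCoeff ℓ s (ω δ / v) (ω δ / c) δ) l (𝓝 (s / 2)) := by
  have hℓ' : (ℓ : ℂ) ≠ 0 := by exact_mod_cast hℓ.ne'
  have hκ : Tendsto (fun δ => ω δ / v) l (𝓝 0) := by simpa using hω.div_const v
  have hk : Tendsto (fun δ => ω δ / c) l (𝓝 0) := by simpa using hω.div_const c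
  have hd : Tendsto (fun δ : ℝ => (δ : ℂ)) l (𝓝 0) := by
    simpa [Function.comp_def] using (Complex.continuous_ofReal.tendsto 0).comp hl
  have tσ := tendsto_sinOver hk ℓ
  have th := ((tendsto_sinOver hk (ℓ / 2)).pow 2).const_mul 2
  have tp := tendsto_cos_mul hκ (s / 2)
  have tq := tendsto_sinOver hκ (s / 2)
  have tr : Tendsto (fun δ => halfGapDown s (ω δ / v)) l (𝓝 0) := by
    simpa [halfGapDown] using ((hκ.pow 2).mul tq).neg
  constructor
  · have := ((tσ.mul tp).add ((th.mul hd).mul tr)).div_const (ℓ : ℂ)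
    rw [show ((ℓ : ℂ) * 1 + 2 * ((ℓ / 2 : ℝ) : ℂ) ^ 2 * 0 * 0) / ℓ = 1 by field_simp; ring] at this
    exact this
  · have := ((tσ.mul tq).add ((th.mul hd).mul tp)).div_const (ℓ : ℂ)
    rw [show ((ℓ : ℂ) * ((s / 2 : ℝ) : ℂ) + 2 * ((ℓ / 2 : ℝ) : ℂ) ^ 2 * 0 * 1) / ℓ = s / 2 by
      push_cast; field_simp; ring] at this
    exact this

theorem tendsto_windowDet {s : ℝ} {v : ℂ} {l : Filter ℝ} {ω : ℝ → ℂ} (hω : Tendsto ω l (𝓝 0)) :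
    Tendsto (fun δ => windowDet s (ω δ / v)) l (𝓝 (s ^ 3 / 64)) := by
  have hκ : Tendsto (fun δ => ω δ / v) l (𝓝 0) := by simpa using hω.div_const v
  have := ((tendsto_sinOver hκ (s / 4)).mul
    (((tendsto_sinOver hκ (s / 2 / 2)).pow 2).const_mul 2)).sub
    ((((tendsto_sinOver hκ (s / 4 / 2)).pow 2).const_mul 2).mul (tendsto_sinOver hκ (s / 2)))
  rw [show ((s / 4 : ℝ) : ℂ) * (2 * ((s / 2 / 2 : ℝ) : ℂ) ^ 2)
    - 2 * ((s / 4 / 2 : ℝ) : ℂ) ^ 2 * ((s / 2 : ℝ) : ℂ) = s ^ 3 / 64 by push_cast; ring] at this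
  exact this

/-- Solutions of a quadratic equation with convergent coefficients approach the roots of the limit
equation. -/
theorem exists_root_approx {ι : Type*} {l : Filter ι} {α β γ E : ι → ℂ} {a b c r₁ r₂ : ℂ}
    (hα : Tendsto α l (𝓝 a)) (hβ : Tendsto β l (𝓝 b)) (hγ : Tendsto γ l (𝓝 c)) (hc : c ≠ 0)
    (heq : ∀ᶠ i in l, α i + β i * E i + γ i * E i ^ 2 = 0)
    (hroots : ∀ z, a + b * z + c * z ^ 2 = c * ((z - r₁) * (z - r₂))) :
    ∃ r : ι → ℂ, (∀ i, r i = r₁ ∨ r i = r₂) ∧ Tendsto (fun i => E i - r i) l (𝓝 0) := by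
  classical
  set M : ℝ := max (‖a / c‖ + 1) (‖b / c‖ + 1) with hM
  have hbound : ∀ᶠ i in l, ‖E i‖ ≤ M + 1 := by
    filter_upwards [heq, hγ.eventually_ne hc,
      (hα.div hγ hc).norm.eventually_lt_const (lt_add_one _),
      (hβ.div hγ hc).norm.eventually_lt_const (lt_add_one _)] with i h1 h2 h3 h4
    simp only [Pi.div_apply] at h3 h4
    have h5 : E i ^ 2 = -(α i / γ i + β i / γ i * E i) := by
      field_simp; linear_combination h1
    have h6 : ‖E i‖ ^ 2 ≤ M + M * ‖E i‖ := by
      rw [← norm_pow, h5, norm_neg]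
      refine (norm_add_le _ _).trans ?_
      rw [norm_mul]
      gcongr
      · exact h3.le.trans (le_max_left _ _)
      · exact h4.le.trans (le_max_right _ _)
    have hM0 : 0 ≤ M := (by positivity : (0 : ℝ) ≤ ‖a / c‖ + 1).trans (le_max_left _ _)
    by_contra! h7
    nlinarith [norm_nonneg (E i)]
  have hbdd : ∀ {f : ι → ℂ}, Tendsto f l (𝓝 0) → ∀ n : ℕ,
      Tendsto (fun i => f i * E i ^ n) l (𝓝 0) := by
    intro f hf n
    refine hf.zero_mul_isBoundedUnder_le (isBoundedUnder_of_eventually_le (a := (M + 1) ^ n) ?_)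
    filter_upwards [hbound] with i hi
    simp only [Function.comp, norm_pow]
    gcongr
  have hprod : Tendsto (fun i => (E i - r₁) * (E i - r₂)) l (𝓝 0) := by
    have h1 : Tendsto (fun i => (a - α i) + (b - β i) * E i ^ 1 + (c - γ i) * E i ^ 2) l (𝓝 0) := by
      have ha := (tendsto_const_nhds (x := a)).sub hα
      have hb := (tendsto_const_nhds (x := b)).sub hβ
      have hc' := (tendsto_const_nhds (x := c)).sub hγ
      rw [sub_self] at ha hb hc'
      simpa using (ha.add (hbdd hb 1)).add (hbdd hc' 2)
    have h2 := h1.div_const c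
    rw [zero_div] at h2
    refine h2.congr' ?_
    filter_upwards [heq] with i hi
    rw [div_eq_iff hc]
    linear_combination hroots (E i) - hi
  refine ⟨fun i => if ‖E i - r₁‖ ≤ ‖E i - r₂‖ then r₁ else r₂,
    fun i => by dsimp only; split_ifs <;> simp, ?_⟩
  rw [tendsto_zero_iff_norm_tendsto_zero] at hprod ⊢
  have hsqrt := (Real.continuous_sqrt.tendsto 0).comp hprod
  rw [Real.sqrt_zero] at hsqrt
  refine squeeze_zero (fun _ => norm_nonneg _) (fun i => ?_) hsqrt
  simp only [Function.comp, norm_mul]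
  apply Real.le_sqrt_of_sq_le
  split_ifs with h
  · nlinarith [norm_nonneg (E i - r₁), norm_nonneg (E i - r₂)]
  · push Not at h
    nlinarith [norm_nonneg (E i - r₁), norm_nonneg (E i - r₂)]

theorem tendsto_quadratic_sub {ι : Type*} {l : Filter ι} {X Y Z E r : ι → ℂ} {X₀ Y₀ Z₀ : ℂ}
    (hX : Tendsto X l (𝓝 X₀)) (hY : Tendsto Y l (𝓝 Y₀)) (hZ : Tendsto Z l (𝓝 Z₀))
    (hE : Tendsto (fun i => E i - r i) l (𝓝 0)) {K : ℝ} (hr : ∀ i, ‖r i‖ ≤ K) :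
    Tendsto (fun i => X i + Y i * E i + Z i * E i ^ 2 - (X₀ + Y₀ * r i + Z₀ * r i ^ 2)) l
      (𝓝 0) := by
  have hbdd : ∀ {f : ι → ℂ}, Tendsto f l (𝓝 0) → ∀ n : ℕ,
      Tendsto (fun i => f i * r i ^ n) l (𝓝 0) := by
    intro f hf n
    refine hf.zero_mul_isBoundedUnder_le (isBoundedUnder_of_eventually_le (a := K ^ n) ?_)
    filter_upwards with i
    simp only [Function.comp, norm_pow]
    exact pow_le_pow_left₀ (norm_nonneg _) (hr i) n
  have hX' := hX.sub_const X₀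
  have hY' := hY.sub_const Y₀
  have hZ' := hZ.sub_const Z₀
  rw [sub_self] at hX' hY' hZ'
  have h1 := ((((hX'.add (hbdd hY' 1)).add (hY.mul hE)).add (hbdd hZ' 2)).add
    (hZ.mul (hE.pow 2))).add ((hbdd (hZ.mul hE |>.trans (by simp)) 1).const_mul 2)
  simp only [mul_zero, add_zero, ne_eq, OfNat.ofNat_ne_zero, not_false_eq_true, zero_pow] at h1
  refine h1.congr fun i => ?_
  ring

theorem eventually_norm_le_of_finite_values {ι : Type*} {l : Filter ι} {b q : ι → ℂ} {b₁ b₂ : ℂ}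
    (hb : ∀ i, b i = b₁ ∨ b i = b₂) (hqb : Tendsto (fun i => q i + b i) l (𝓝 0))
    (hq : ∀ᶠ i in l, ‖q i‖ < 1) : ∀ᶠ i in l, ‖b i‖ ≤ 1 := by
  have key : ∀ β : ℂ, ∀ᶠ i in l, b i = β → ‖b i‖ ≤ 1 := by
    intro β
    by_cases hβ : ‖β‖ ≤ 1
    · exact Eventually.of_forall fun i h => h ▸ hβ
    · push Not at hβ
      have h1 := hqb.norm.eventually_lt_const (u := ‖β‖ - 1) (by simpa using hβ)
      filter_upwards [h1, hq] with i h2 h3 h4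
      exfalso
      rw [h4] at h2
      have h5 : ‖β‖ ≤ ‖q i + β‖ + ‖q i‖ := by
        simpa using norm_sub_le (q i + β) (q i)
      linarith
  filter_upwards [key b₁, key b₂] with i h1 h2
  exact (hb i).elim h1 h2

/-- Boundary values of a capacitance potential. -/
theorem IsCapacitancePotential.boundary_values {ℓ s α : ℝ} (hℓ : 0 < ℓ) {j : Fin 2} {V : ℝ → ℂ}
    (hV : IsCapacitancePotential ℓ s α j V) (i : Fin 2) (m : ℤ) :
    V (leftEnd ℓ s i m) = Complex.exp (Complex.I * α * m * period ℓ s) * (if i = j then 1 else 0) ∧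
      V (rightEnd ℓ s i m) =
        Complex.exp (Complex.I * α * m * period ℓ s) * (if i = j then 1 else 0) := by
  have h1 : EqOn V (fun _ => if i = j then 1 else 0)
      (Icc (leftEnd ℓ s i 0) (rightEnd ℓ s i 0)) :=
    EqOn.of_subset_closure (s := resonator ℓ s i 0) (hV.on_resonators i)
      hV.continuous.continuousOn continuousOn_const Ioo_subset_Icc_self
      (by rw [resonator, closure_Ioo (by rw [rightEnd]; linarith)])
  have hle : leftEnd ℓ s i 0 ≤ rightEnd ℓ s i 0 := by rw [rightEnd]; linarith
  have e1 : leftEnd ℓ s i m = leftEnd ℓ s i 0 + m * period ℓ s := by simp [leftEnd]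
  have e2 : rightEnd ℓ s i m = rightEnd ℓ s i 0 + m * period ℓ s := by
    simp only [rightEnd, e1]; ring
  rw [e1, e2, hV.quasiperiodic, hV.quasiperiodic, h1 ⟨le_rfl, hle⟩, h1 ⟨hle, le_rfl⟩]
  exact ⟨rfl, rfl⟩

/-- One-sided derivatives of a capacitance potential at the ends of a gap. -/
theorem IsCapacitancePotential.gap_slope {ℓ s α : ℝ} (hs : 0 < s) {j : Fin 2} {V : ℝ → ℂ}
    (hV : IsCapacitancePotential ℓ s α j V) (i : Fin 2) (m : ℤ) :
    DerivLimRight V (rightEnd ℓ s i m)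
        ((V (rightEnd ℓ s i m + s) - V (rightEnd ℓ s i m)) / s) ∧
      DerivLimLeft V (rightEnd ℓ s i m + s)
        ((V (rightEnd ℓ s i m + s) - V (rightEnd ℓ s i m)) / s) := by
  set a := rightEnd ℓ s i m
  have hs' : (s : ℂ) ≠ 0 := by exact_mod_cast hs.ne'
  have hlt : a < a + s := by linarith
  obtain ⟨B, h, h'⟩ := exists_fundamental_representation (u := V) hlt (k := 0)
    hV.continuous.continuousOn (fun x hx => by simpa using hV.harmonic i m x hx)
  have hB : (V (a + s) - V a) / s = B := by
    rw [h (a + s) ⟨hlt.le, le_rfl⟩]; simp; field_simp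
  rw [hB]
  simp only [ne_eq, OfNat.ofNat_ne_zero, not_false_eq_true, zero_pow, zero_mul, neg_zero,
    Complex.cos_zero, one_mul, zero_add] at h'
  constructor
  · refine tendsto_const_nhds.congr' ?_
    filter_upwards [Ioo_mem_nhdsGT hlt] with x hx using (h' x hx).symm
  · refine tendsto_const_nhds.congr' ?_
    filter_upwards [Ioo_mem_nhdsLT hlt] with x hx using (h' x hx).symm

/-- The capacitance matrix is unique. -/
theorem IsCapacitanceMatrix.eq_explicit {ℓ s α : ℝ} (hℓ : 0 < ℓ) (hs : 0 < s)
    {C : Matrix (Fin 2) (Fin 2) ℂ} (hC : IsCapacitanceMatrix ℓ s α C) :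
    C = !![2 / (s : ℂ), -(1 + Complex.exp (-(Complex.I * α * period ℓ s))) / s;
        -(1 + Complex.exp (Complex.I * α * period ℓ s)) / s, 2 / s] := by
  obtain ⟨V, hV, hCV⟩ := hC
  have g0 : rightEnd ℓ s 0 0 + s = leftEnd ℓ s 1 0 := by simp [rightEnd, leftEnd]
  have g1 : rightEnd ℓ s 1 (-1) + s = leftEnd ℓ s 0 0 := by
    simp [rightEnd, leftEnd, period]; ring
  have g2 : rightEnd ℓ s 1 0 + s = leftEnd ℓ s 0 1 := by
    simp [rightEnd, leftEnd, period]; ring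
  have hval : ∀ j, C 0 j = -(-((V j (leftEnd ℓ s 0 0) - V j (rightEnd ℓ s 1 (-1))) / s)
        + (V j (leftEnd ℓ s 1 0) - V j (rightEnd ℓ s 0 0)) / s) ∧
      C 1 j = -(-((V j (leftEnd ℓ s 1 0) - V j (rightEnd ℓ s 0 0)) / s)
        + (V j (leftEnd ℓ s 0 1) - V j (rightEnd ℓ s 1 0)) / s) := by
    intro j
    have s0 := (hV j).gap_slope hs 0 0
    have s1 := (hV j).gap_slope hs 1 (-1)
    have s2 := (hV j).gap_slope hs 1 0
    rw [g0] at s0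
    rw [g1] at s1
    rw [g2] at s2
    obtain ⟨a, b, ha, hb, hab⟩ := hCV 0 j
    obtain ⟨a', b', ha', hb', hab'⟩ := hCV 1 j
    rw [hab, hab', tendsto_nhds_unique ha s1.2, tendsto_nhds_unique hb s0.1,
      tendsto_nhds_unique ha' s0.2, tendsto_nhds_unique hb' s2.1]
    exact ⟨rfl, rfl⟩
  simp only [fun j i m => ((hV j).boundary_values hℓ i m).1,
    fun j i m => ((hV j).boundary_values hℓ i m).2] at hval
  ext i j
  fin_cases i <;> fin_cases j
  · simp [(hval 0).1]; ring
  · simp [(hval 1).1]; ring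
  · simp [(hval 0).2]; ring
  · simp [(hval 1).2]; ring

/-- Decay ratio `b` and rescaled squared frequency `r` of a localised mode in the limit of high
contrast. -/
def IsLimitPair (s : ℝ) (v₁ v₂ b r : ℂ) : Prop :=
  ‖b‖ ≤ 1 ∧ (‖v₁‖ ≠ ‖v₂‖ → ‖b‖ < 1) ∧ (b ≠ -(v₁ ^ 2 / v₂ ^ 2) → b ≠ v₁ ^ 2 / v₂ ^ 2) ∧
    ∃ γ : ℂ, γ ^ 2 = 1 ∧ s * r * (v₂ ^ 2)⁻¹ = 2 - γ - b ∧
      b * (s * r * (v₁ ^ 2)⁻¹) = (2 - γ) * b - 1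

theorem IsLimitPair.exists_eigenvector {ℓ s δ α : ℝ} (hℓ : 0 < ℓ) (hs : 0 < s) (hδ : δ ≠ 0)
    {v₁ v₂ b r : ℂ} (h : IsLimitPair s v₁ v₂ b r)
    {C : Matrix (Fin 2) (Fin 2) ℂ} (hC : IsCapacitanceMatrix ℓ s α C) :
    ∃ x : Fin 2 → ℂ, x ≠ 0 ∧
      (C * matA b).mulVec x = (δ * r) • (matB δ v₁ v₂ b).mulVec x := by
  obtain ⟨-, -, -, γ, hγ, h1, h2⟩ := h
  have hs' : (s : ℂ) ≠ 0 := by exact_mod_cast hs.ne'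
  have hδ' : (δ : ℂ) ≠ 0 := by exact_mod_cast hδ
  have hinv : (δ : ℂ) * (δ : ℂ)⁻¹ = 1 := mul_inv_cancel₀ hδ'
  rw [hC.eq_explicit hℓ hs]
  set z := Complex.exp (Complex.I * α * period ℓ s) with hz
  have hz0 : z ≠ 0 := Complex.exp_ne_zero _
  rw [Complex.exp_neg, ← hz]
  have key : ∀ x y : ℂ, (γ * z - b) * x + (γ * b * z - 1) * y = 0 →
      (γ * b - z) * x + (γ - z * b) * y = 0 →
      (!![2 / (s : ℂ), -(1 + z⁻¹) / s; -(1 + z) / s, 2 / s] * matA b).mulVec ![x, y]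
        = (δ * r) • (matB δ v₁ v₂ b).mulVec ![x, y] := by
    intro x y e1 e2
    have r1 : r * (v₂ ^ 2)⁻¹ = (2 - γ - b) / s := by
      rw [← h1]; field_simp
    have r2 : r * (b * (v₁ ^ 2)⁻¹) = ((2 - γ) * b - 1) / s := by
      rw [← h2]; field_simp
    ext i
    fin_cases i
    · simp [matA, matB, Matrix.mulVec, dotProduct, Fin.sum_univ_two, Matrix.mul_apply]
      have : δ * r * (x * ((δ : ℂ)⁻¹ * (v₂ ^ 2)⁻¹) + y * ((δ : ℂ)⁻¹ * (b * (v₁ ^ 2)⁻¹)))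
          = r * (v₂ ^ 2)⁻¹ * x + r * (b * (v₁ ^ 2)⁻¹) * y := by
        linear_combination (r * (v₂ ^ 2)⁻¹ * x + r * (b * (v₁ ^ 2)⁻¹) * y) * hinv
      rw [this, r1, r2]
      field_simp
      linear_combination e1
    · simp [matA, matB, Matrix.mulVec, dotProduct, Fin.sum_univ_two, Matrix.mul_apply]
      have : δ * r * (x * ((δ : ℂ)⁻¹ * (b * (v₁ ^ 2)⁻¹)) + y * ((δ : ℂ)⁻¹ * (v₂ ^ 2)⁻¹))
          = r * (b * (v₁ ^ 2)⁻¹) * x + r * (v₂ ^ 2)⁻¹ * y := by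
        linear_combination (r * (b * (v₁ ^ 2)⁻¹) * x + r * (v₂ ^ 2)⁻¹ * y) * hinv
      rw [this, r1, r2]
      field_simp
      linear_combination e2
  by_cases hx : γ * z - b = 0
  · by_cases hx' : 1 - γ * b * z = 0
    · have hb : b = γ * z := by linear_combination -hx
      have hzz : z ^ 2 = 1 := by rw [hb] at hx'; linear_combination -hx' - z ^ 2 * hγ
      refine ⟨![1, -b], fun h0 => by simpa using congrFun h0 0, key _ _ ?_ ?_⟩
      · rw [hb]; linear_combination (-γ * z ^ 3) * hγ - γ * z * hzz
      · rw [hb]; linear_combination z ^ 3 * hγ + z * hzz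
    · refine ⟨![1 - γ * b * z, γ * z - b], fun h0 => hx' (by simpa using congrFun h0 0),
        key _ _ ?_ ?_⟩
      · ring
      · linear_combination (z - b ^ 2 * z) * hγ
  · refine ⟨![1 - γ * b * z, γ * z - b], fun h0 => hx (by simpa using congrFun h0 1),
      key _ _ ?_ ?_⟩
    · ring
    · linear_combination (z - b ^ 2 * z) * hγ

theorem IsLimitPair.isUnit_matB {s δ : ℝ} (hδ : δ ≠ 0) {v₁ v₂ b r : ℂ} (hv₁ : v₁ ≠ 0)
    (hv₂ : v₂ ≠ 0) (h : IsLimitPair s v₁ v₂ b r) (hb : b ≠ -(v₁ ^ 2 / v₂ ^ 2)) :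
    IsUnit (matB δ v₁ v₂ b) := by
  have hδ' : (δ : ℂ) ≠ 0 := by exact_mod_cast hδ
  have hb' := h.2.2.1 hb
  rw [Matrix.isUnit_iff_isUnit_det, isUnit_iff_ne_zero]
  have hdet : (matB δ v₁ v₂ b).det
      = -((b - v₁ ^ 2 / v₂ ^ 2) * (b - -(v₁ ^ 2 / v₂ ^ 2))) / (δ ^ 2 * v₁ ^ 4) := by
    simp [matB, Matrix.det_fin_two]
    field_simp
    ring
  rw [hdet]
  exact div_ne_zero (neg_ne_zero.2 (mul_ne_zero (sub_ne_zero.2 hb') (sub_ne_zero.2 hb)))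
    (mul_ne_zero (pow_ne_zero _ hδ') (pow_ne_zero _ hv₁))

theorem hasEigenvalue_of_generalised {A B : Matrix (Fin 2) (Fin 2) ℂ} {C : Matrix (Fin 2) (Fin 2) ℂ}
    {μ : ℂ} (hB : IsUnit B) {x : Fin 2 → ℂ} (hx : x ≠ 0)
    (h : (C * A).mulVec x = μ • B.mulVec x) :
    Module.End.HasEigenvalue (Matrix.toLin' (B⁻¹ * C * A)) μ := by
  refine Module.End.hasEigenvalue_of_hasEigenvector (x := x)
    ⟨Module.End.mem_eigenspace_iff.2 ?_, hx⟩
  rw [Matrix.toLin'_apply, mul_assoc, ← Matrix.mulVec_mulVec, h, Matrix.mulVec_smul,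
    Matrix.mulVec_mulVec, Matrix.nonsing_inv_mul _ ((Matrix.isUnit_iff_isUnit_det _).1 hB),
    Matrix.one_mulVec]

theorem isLimitPair_even {s : ℝ} (hs : 0 < s) {v₁ v₂ : ℂ} (hv₁ : v₁ ≠ 0) (hv₂ : v₂ ≠ 0)
    (h : ‖-(v₁ ^ 2 / v₂ ^ 2)‖ ≤ 1) :
    IsLimitPair s v₁ v₂ (-(v₁ ^ 2 / v₂ ^ 2)) ((v₁ ^ 2 + v₂ ^ 2) / s) := by
  have hs' : (s : ℂ) ≠ 0 := by exact_mod_cast hs.ne'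
  refine ⟨h, fun hne => lt_of_le_of_ne h fun h1 => hne ?_, fun h1 => absurd rfl h1, 1, by simp,
    ?_, ?_⟩
  · rw [norm_neg, norm_div, norm_pow, norm_pow, div_eq_one_iff_eq (by positivity)] at h1
    exact (pow_left_inj₀ (norm_nonneg _) (norm_nonneg _) two_ne_zero).1 h1
  · field_simp; ring
  · field_simp; ring

theorem isLimitPair_odd {s : ℝ} {v₁ v₂ r : ℂ} (hv₁ : v₁ ≠ 0) (hv₂ : v₂ ≠ 0)
    (hne : v₁ ^ 2 ≠ v₂ ^ 2)
    (hr : (s * r) ^ 2 - 3 * (v₁ ^ 2 + v₂ ^ 2) * (s * r) + 8 * (v₁ ^ 2 * v₂ ^ 2) = 0)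
    (h : ‖3 - s * r / v₂ ^ 2‖ ≤ 1) :
    IsLimitPair s v₁ v₂ (3 - s * r / v₂ ^ 2) r := by
  set y : ℂ := s * r with hy
  have hprod : (3 - y / v₂ ^ 2) * (3 - y / v₁ ^ 2) = 1 := by
    field_simp; linear_combination hr
  refine ⟨h, fun hn => lt_of_le_of_ne h fun h1 => hn ?_, fun _ h1 => hne ?_, -1, by simp, ?_, ?_⟩
  · have hinv := Complex.inv_eq_conj h1
    have h2 : (starRingEnd ℂ) (3 - y / v₂ ^ 2) = 3 - y / v₁ ^ 2 := by
      rw [← hinv]; exact inv_eq_of_mul_eq_one_right hprod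
    have h3 : ‖y / v₂ ^ 2‖ = ‖y / v₁ ^ 2‖ := by
      have h4 : (starRingEnd ℂ) (y / v₂ ^ 2) = y / v₁ ^ 2 := by
        rw [map_sub] at h2
        have h5 : (starRingEnd ℂ) (3 : ℂ) = 3 := Complex.conj_ofNat 3
        rw [h5] at h2
        linear_combination -h2
      rw [← h4, Complex.norm_conj]
    have hy0 : y ≠ 0 := by
      intro h0
      rw [h0] at hr
      have : v₁ ^ 2 * v₂ ^ 2 = 0 := by linear_combination hr / 8
      exact mul_ne_zero (pow_ne_zero _ hv₁) (pow_ne_zero _ hv₂) this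
    rw [norm_div, norm_div, norm_pow, norm_pow, div_eq_div_iff (by positivity) (by positivity)] at h3
    have h6 := mul_left_cancel₀ (norm_ne_zero_iff.2 hy0) h3
    exact (pow_left_inj₀ (norm_nonneg _) (norm_nonneg _) two_ne_zero).1 h6
  · have h2 : y = 3 * v₂ ^ 2 - v₁ ^ 2 := by
      field_simp at h1; linear_combination -h1
    rw [h2] at hr
    have h3 : v₁ ^ 2 * (v₁ ^ 2 - v₂ ^ 2) = 0 := by linear_combination hr / 4
    exact sub_eq_zero.1 ((mul_eq_zero.1 h3).resolve_left (pow_ne_zero _ hv₁))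
  · ring
  · linear_combination -hprod

/-- Along the filter `l`, the decay ratio and the scaled squared frequency of the modes `u δ` are
approximated by limit pairs. -/
def HasLimitPairs (ℓ s : ℝ) (v₁ v₂ : ℂ) (ω : ℝ → ℂ) (u : ℝ → ℝ → ℂ) (l : Filter ℝ) : Prop :=
  ∃ b b' r : ℝ → ℂ,
    (∀ᶠ δ in l, IsDecayRatio ℓ s (u δ) (b' δ) ∧ IsLimitPair s v₁ v₂ (b δ) (r δ)) ∧
      Tendsto (fun δ => b' δ - b δ) l (𝓝 0) ∧
      Tendsto (fun δ : ℝ => ℓ * ω δ ^ 2 / δ - r δ) l (𝓝 0)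

theorem HasLimitPairs.of_inf_principal {ℓ s : ℝ} {v₁ v₂ : ℂ} {ω : ℝ → ℂ} {u : ℝ → ℝ → ℂ}
    {l : Filter ℝ} (S : Set ℝ) (h₁ : HasLimitPairs ℓ s v₁ v₂ ω u (l ⊓ 𝓟 S))
    (h₂ : HasLimitPairs ℓ s v₁ v₂ ω u (l ⊓ 𝓟 Sᶜ)) : HasLimitPairs ℓ s v₁ v₂ ω u l := by
  classical
  obtain ⟨b₁, b₁', r₁, e₁, tb₁, tr₁⟩ := h₁
  obtain ⟨b₂, b₂', r₂, e₂, tb₂, tr₂⟩ := h₂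
  rw [eventually_inf_principal] at e₁ e₂
  refine ⟨S.piecewise b₁ b₂, S.piecewise b₁' b₂', S.piecewise r₁ r₂, ?_, ?_, ?_⟩
  · filter_upwards [e₁, e₂] with δ h1 h2
    by_cases hδ : δ ∈ S
    · simpa only [piecewise_eq_of_mem _ _ _ hδ] using h1 hδ
    · simpa only [piecewise_eq_of_notMem _ _ _ hδ] using h2 hδ
  · refine (tb₁.piecewise tb₂).congr fun δ => ?_
    by_cases hδ : δ ∈ S <;> simp [hδ]
  · refine (tr₁.piecewise tr₂).congr fun δ => ?_
    by_cases hδ : δ ∈ S <;> simp [hδ]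

theorem HasLimitPairs.of_bot {ℓ s : ℝ} {v₁ v₂ : ℂ} {ω : ℝ → ℂ} {u : ℝ → ℝ → ℂ} :
    HasLimitPairs ℓ s v₁ v₂ ω u ⊥ := by
  simp [HasLimitPairs]

/-- Modes that are even with respect to the centre of the defect have limit pairs with decay ratio
`-v₁² / v₂²`. -/
theorem hasLimitPairs_even {ℓ s : ℝ} (hℓ : 0 < ℓ) (hs : 0 < s) {v v₁ v₂ : ℂ} (hv : v ≠ 0)
    (hv₁ : v₁ ≠ 0) (hv₂ : v₂ ≠ 0) {ω : ℝ → ℂ} {u : ℝ → ℝ → ℂ} {l : Filter ℝ} [l.NeBot]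
    (hl : Tendsto (fun δ : ℝ => δ) l (𝓝 0)) (hω : Tendsto ω l (𝓝 0))
    (hne : ∀ᶠ δ in l, δ ≠ 0 ∧ ω δ ≠ 0)
    (h : ∀ᶠ δ in l, HasEvenDispersion ℓ s v v₁ v₂ δ (ω δ) (u δ)) :
    HasLimitPairs ℓ s v₁ v₂ ω u l := by
  have hs' : (s : ℂ) ≠ 0 := by exact_mod_cast hs.ne'
  have hℓ' : (ℓ : ℂ) ≠ 0 := by exact_mod_cast hℓ.ne'
  obtain ⟨A₁, B₁, F₁, H₁, G₁, e₁, tA₁, tB₁, tF₁, tH₁, tG₁⟩ :=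
    cell_asymptotics (s := s) hℓ hv hv₁ hl hω
  obtain ⟨A₂, B₂, F₂, H₂, G₂, e₂, tA₂, tB₂, tF₂, tH₂, tG₂⟩ :=
    cell_asymptotics (s := s) hℓ hv hv₂ hl hω
  obtain ⟨tP₁, tQ₁⟩ := mean_asymptotics (s := s) (v := v) (c := v₁) hℓ hl hω
  obtain ⟨tP₂, tQ₂⟩ := mean_asymptotics (s := s) (v := v) (c := v₂) hℓ hl hω
  set E : ℝ → ℂ := fun δ => ℓ * ω δ ^ 2 / δ with hE
  have tden := (tG₁.mul tB₂).add (tB₁.mul tG₂)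
  have hden : -(1 / v₁ ^ 2) * -(s / (2 * v₂ ^ 2)) + -(s / (2 * v₁ ^ 2)) * -(1 / v₂ ^ 2)
      = s / (v₁ ^ 2 * v₂ ^ 2) := by field_simp; norm_num
  rw [hden] at tden
  have hden0 : s / (v₁ ^ 2 * v₂ ^ 2) ≠ 0 :=
    div_ne_zero hs' (mul_ne_zero (pow_ne_zero _ hv₁) (pow_ne_zero _ hv₂))
  have tE : Tendsto E l (𝓝 ((v₁ ^ 2 + v₂ ^ 2) / s)) := by
    have h1 := (((tG₁.mul tA₂).add (tA₁.mul tG₂)).neg).div tden hden0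
    rw [show -(-(1 / v₁ ^ 2) * 1 + 1 * -(1 / v₂ ^ 2)) / (s / (v₁ ^ 2 * v₂ ^ 2))
      = (v₁ ^ 2 + v₂ ^ 2) / s by field_simp; ring] at h1
    refine h1.congr' ?_
    filter_upwards [h, hne, tden.eventually_ne hden0] with δ h2 h3 h4
    have hE0 : E δ ≠ 0 := div_ne_zero (mul_ne_zero hℓ' (pow_ne_zero _ h3.2))
      (by exact_mod_cast h3.1)
    have h5 := h2.1
    rw [(e₁ δ h3.1).1, (e₁ δ h3.1).2.2, (e₂ δ h3.1).1, (e₂ δ h3.1).2.2] at h5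
    change -(G₁ δ * A₂ δ + A₁ δ * G₂ δ) / (G₁ δ * B₂ δ + B₁ δ * G₂ δ) = E δ
    rw [div_eq_iff h4]
    apply mul_left_cancel₀ hE0
    linear_combination -h5
  have tD : Tendsto (fun δ => cellDiag ℓ s (ω δ / v) (ω δ / v₂) δ) l
      (𝓝 (1 + -(s / (2 * v₂ ^ 2)) * ((v₁ ^ 2 + v₂ ^ 2) / s))) :=
    (tA₂.add (tB₂.mul tE)).congr' (hne.mono fun δ hδ => ((e₂ δ hδ.1).1).symm)
  have tD₁ : Tendsto (fun δ => cellDiag ℓ s (ω δ / v) (ω δ / v₁) δ) l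
      (𝓝 (1 + -(s / (2 * v₁ ^ 2)) * ((v₁ ^ 2 + v₂ ^ 2) / s))) :=
    (tA₁.add (tB₁.mul tE)).congr' (hne.mono fun δ hδ => ((e₁ δ hδ.1).1).symm)
  have tU₁ : Tendsto (fun δ => cellUp ℓ s (ω δ / v) (ω δ / v₁) δ) l
      (𝓝 (s + -(s ^ 2 / (4 * v₁ ^ 2)) * ((v₁ ^ 2 + v₂ ^ 2) / s))) :=
    (tF₁.add (tH₁.mul tE)).congr' (hne.mono fun δ hδ => ((e₁ δ hδ.1).2.1).symm)
  have tL : Tendsto (fun δ => cellDown ℓ s (ω δ / v) (ω δ / v₂) δ) l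
      (𝓝 (-(1 / v₂ ^ 2) * ((v₁ ^ 2 + v₂ ^ 2) / s))) :=
    (tG₂.mul tE).congr' (hne.mono fun δ hδ => ((e₂ δ hδ.1).2.2).symm)
  have tq := (tD₁.mul tD).add (tU₁.mul tL)
  rw [show (1 + -(s / (2 * v₁ ^ 2)) * ((v₁ ^ 2 + v₂ ^ 2) / s))
      * (1 + -(s / (2 * v₂ ^ 2)) * ((v₁ ^ 2 + v₂ ^ 2) / s))
      + (s + -(s ^ 2 / (4 * v₁ ^ 2)) * ((v₁ ^ 2 + v₂ ^ 2) / s))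
        * (-(1 / v₂ ^ 2) * ((v₁ ^ 2 + v₂ ^ 2) / s)) = -(v₁ ^ 2 / v₂ ^ 2) by
    field_simp; ring] at tq
  have hle : ‖-(v₁ ^ 2 / v₂ ^ 2)‖ ≤ 1 :=
    le_of_tendsto tq.norm (h.mono fun δ hδ => hδ.2.1.le)
  have tb := ((tP₁.mul tD).add (tQ₁.mul tL)).div tP₂ one_ne_zero
  rw [show (1 * (1 + -(s / (2 * v₂ ^ 2)) * ((v₁ ^ 2 + v₂ ^ 2) / s))
      + s / 2 * (-(1 / v₂ ^ 2) * ((v₁ ^ 2 + v₂ ^ 2) / s))) / 1 = -(v₁ ^ 2 / v₂ ^ 2) by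
    field_simp; ring] at tb
  refine ⟨fun _ => -(v₁ ^ 2 / v₂ ^ 2), _, fun _ => (v₁ ^ 2 + v₂ ^ 2) / s, ?_,
    tendsto_sub_nhds_zero_iff.2 tb, tendsto_sub_nhds_zero_iff.2 tE⟩
  filter_upwards [h, tP₂.eventually_ne one_ne_zero] with δ h1 h2
  exact ⟨h1.2.2 h2, isLimitPair_even hs hv₁ hv₂ hle⟩

/-- Modes that are odd with respect to the centre of the defect have limit pairs. -/
theorem hasLimitPairs_odd {ℓ s : ℝ} (hℓ : 0 < ℓ) (hs : 0 < s) {v v₁ v₂ : ℂ} (hv : v ≠ 0)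
    (hv₁ : v₁ ≠ 0) (hv₂ : v₂ ≠ 0) (hsq : v₁ ^ 2 ≠ v₂ ^ 2) {ω : ℝ → ℂ} {u : ℝ → ℝ → ℂ}
    {l : Filter ℝ} (hl : Tendsto (fun δ : ℝ => δ) l (𝓝 0)) (hω : Tendsto ω l (𝓝 0))
    (hne : ∀ᶠ δ in l, δ ≠ 0)
    (h : ∀ᶠ δ in l, HasOddDispersion ℓ s v v₁ v₂ δ (ω δ) (u δ)) :
    HasLimitPairs ℓ s v₁ v₂ ω u l := by
  have hs' : (s : ℂ) ≠ 0 := by exact_mod_cast hs.ne'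
  obtain ⟨A₁, B₁, F₁, H₁, G₁, e₁, tA₁, tB₁, tF₁, tH₁, tG₁⟩ :=
    cell_asymptotics (s := s) hℓ hv hv₁ hl hω
  obtain ⟨A₂, B₂, F₂, H₂, G₂, e₂, tA₂, tB₂, tF₂, tH₂, tG₂⟩ :=
    cell_asymptotics (s := s) hℓ hv hv₂ hl hω
  obtain ⟨tP₁, tQ₁⟩ := mean_asymptotics (s := s) (v := v) (c := v₁) hℓ hl hω
  obtain ⟨tP₂, tQ₂⟩ := mean_asymptotics (s := s) (v := v) (c := v₂) hℓ hl hω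
  have hs2 : (s : ℂ) / 2 ≠ 0 := div_ne_zero hs' two_ne_zero
  set E : ℝ → ℂ := fun δ => ℓ * ω δ ^ 2 / δ with hE
  -- roots of the limit equation
  obtain ⟨d, hd⟩ := IsAlgClosed.exists_pow_nat_eq
    (9 * (v₁ ^ 2 + v₂ ^ 2) ^ 2 - 32 * (v₁ ^ 2 * v₂ ^ 2)) (zero_lt_two)
  set r₁ : ℂ := (3 * (v₁ ^ 2 + v₂ ^ 2) + d) / (2 * s) with hr₁
  set r₂ : ℂ := (3 * (v₁ ^ 2 + v₂ ^ 2) - d) / (2 * s) with hr₂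
  have hfac : ∀ z : ℂ, (s * z) ^ 2 - 3 * (v₁ ^ 2 + v₂ ^ 2) * (s * z) + 8 * (v₁ ^ 2 * v₂ ^ 2)
      = s ^ 2 * ((z - r₁) * (z - r₂)) := by
    intro z
    have a1 : s * (z - r₁) = s * z - (3 * (v₁ ^ 2 + v₂ ^ 2) + d) / 2 := by
      rw [hr₁]; field_simp
    have a2 : s * (z - r₂) = s * z - (3 * (v₁ ^ 2 + v₂ ^ 2) - d) / 2 := by
      rw [hr₂]; field_simp
    rw [show (s : ℂ) ^ 2 * ((z - r₁) * (z - r₂)) = s * (z - r₁) * (s * (z - r₂)) by ring, a1, a2]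
    linear_combination hd / 4
  obtain ⟨r, hr, tr⟩ := exists_root_approx (E := E) (r₁ := r₁) (r₂ := r₂)
    ((tA₁.mul tF₂).add (tF₁.mul tA₂))
    ((((tA₁.mul tH₂).add (tB₁.mul tF₂)).add (tF₁.mul tB₂)).add (tH₁.mul tA₂))
    ((tB₁.mul tH₂).add (tH₁.mul tB₂))
    (by
      rw [show -(s / (2 * v₁ ^ 2)) * -((s : ℂ) ^ 2 / (4 * v₂ ^ 2))
        + -((s : ℂ) ^ 2 / (4 * v₁ ^ 2)) * -(s / (2 * v₂ ^ 2))
        = s ^ 3 / (4 * (v₁ ^ 2 * v₂ ^ 2)) by field_simp; norm_num]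
      exact div_ne_zero (pow_ne_zero _ hs') (by simp [hv₁, hv₂]))
    (by
      filter_upwards [h, hne] with δ h1 h2
      have h3 := h1.1
      rw [(e₁ δ h2).1, (e₁ δ h2).2.1, (e₂ δ h2).1, (e₂ δ h2).2.1] at h3
      linear_combination h3)
    (fun z => by
      have := hfac z
      have h5 : (z - r₁) * (z - r₂) = ((s * z) ^ 2 - 3 * (v₁ ^ 2 + v₂ ^ 2) * (s * z)
          + 8 * (v₁ ^ 2 * v₂ ^ 2)) / s ^ 2 := by
        rw [this]; field_simp
      rw [h5]; field_simp; ring)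
  have hroot : ∀ δ, (s * r δ) ^ 2 - 3 * (v₁ ^ 2 + v₂ ^ 2) * (s * r δ)
      + 8 * (v₁ ^ 2 * v₂ ^ 2) = 0 := by
    intro δ
    rw [hfac]
    rcases hr δ with h1 | h1 <;> simp [h1]
  have hK : ∀ δ, ‖r δ‖ ≤ max ‖r₁‖ ‖r₂‖ := by
    intro δ
    rcases hr δ with h1 | h1 <;> simp [h1]
  have tb := tendsto_quadratic_sub (((tP₁.mul tF₂).add (tQ₁.mul tA₂)).div tQ₂ hs2)
    (((tP₁.mul tH₂).add (tQ₁.mul tB₂)).div tQ₂ hs2) (tendsto_const_nhds (x := (0 : ℂ))) tr hK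
  have tq := tendsto_quadratic_sub (tA₁.mul tA₂)
    (((tA₁.mul tB₂).add (tB₁.mul tA₂)).add (tG₁.mul tF₂))
    ((tB₁.mul tB₂).add (tG₁.mul tH₂)) tr hK
  have tq' : Tendsto (fun δ =>
      (cellDiag ℓ s (ω δ / v) (ω δ / v₁) δ * cellDiag ℓ s (ω δ / v) (ω δ / v₂) δ
        + cellDown ℓ s (ω δ / v) (ω δ / v₁) δ * cellUp ℓ s (ω δ / v) (ω δ / v₂) δ)
      + (3 - s * r δ / v₂ ^ 2)) l (𝓝 0) := by
    refine tq.congr' ?_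
    filter_upwards [hne] with δ hδ
    rw [(e₁ δ hδ).1, (e₁ δ hδ).2.2, (e₂ δ hδ).1, (e₂ δ hδ).2.1]
    have h6 : (1 : ℂ) * 1 + (1 * -(s / (2 * v₂ ^ 2)) + -(s / (2 * v₁ ^ 2)) * 1
          + -(1 / v₁ ^ 2) * s) * r δ
        + (-(s / (2 * v₁ ^ 2)) * -(s / (2 * v₂ ^ 2))
          + -(1 / v₁ ^ 2) * -(s ^ 2 / (4 * v₂ ^ 2))) * r δ ^ 2 = -(3 - s * r δ / v₂ ^ 2) := by
      field_simp
      linear_combination 8 * hroot δ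
    rw [h6]; ring
  have hnorm := eventually_norm_le_of_finite_values (b := fun δ => 3 - s * r δ / v₂ ^ 2)
    (b₁ := 3 - s * r₁ / v₂ ^ 2) (b₂ := 3 - s * r₂ / v₂ ^ 2)
    (fun δ => (hr δ).imp (fun h => by rw [h]) (fun h => by rw [h])) tq'
    (h.mono fun δ hδ => hδ.2.1)
  refine ⟨fun δ => 3 - s * r δ / v₂ ^ 2, fun δ =>
    (meanValueCoeff ℓ s (ω δ / v) (ω δ / v₁) δ * cellUp ℓ s (ω δ / v) (ω δ / v₂) δ
      + meanDerivCoeff ℓ s (ω δ / v) (ω δ / v₁) δ * cellDiag ℓ s (ω δ / v) (ω δ / v₂) δ)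
      / meanDerivCoeff ℓ s (ω δ / v) (ω δ / v₂) δ, r, ?_, ?_, tr⟩
  · filter_upwards [h, tQ₂.eventually_ne hs2, hnorm] with δ h1 h2 h3
    exact ⟨h1.2.2 h2, isLimitPair_odd hv₁ hv₂ hsq (hroot δ) h3⟩
  · refine tb.congr' ?_
    filter_upwards [hne, tQ₂.eventually_ne hs2] with δ hδ hQ
    rw [(e₂ δ hδ).1, (e₂ δ hδ).2.1]
    have h6 : (1 * s + s / 2 * 1) / ((s : ℂ) / 2)
        + (1 * -(s ^ 2 / (4 * v₂ ^ 2)) + s / 2 * -(s / (2 * v₂ ^ 2))) / ((s : ℂ) / 2) * r δ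
        + 0 * r δ ^ 2 = 3 - s * r δ / v₂ ^ 2 := by
      field_simp; ring
    rw [h6]
    simp only [Pi.div_apply]
    field_simp
    ring

theorem hasLimitPairs {ℓ s : ℝ} (hℓ : 0 < ℓ) (hs : 0 < s) {v v₁ v₂ : ℂ} (hv : v ≠ 0)
    (hv₁ : v₁ ≠ 0) (hv₂ : v₂ ≠ 0) {ω : ℝ → ℂ} {u : ℝ → ℝ → ℂ}
    (hω : Tendsto ω (𝓝[>] 0) (𝓝 0))
    (hu : ∀ᶠ δ in 𝓝[>] (0 : ℝ), IsLocalisedMode ℓ s v v₁ v₂ δ (ω δ) (u δ)) :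
    HasLimitPairs ℓ s v₁ v₂ ω u (𝓝[>] 0) := by
  have hl : Tendsto (fun δ : ℝ => δ) (𝓝[>] 0) (𝓝 0) := nhdsWithin_le_nhds
  have hwin : ∀ᶠ δ in 𝓝[>] (0 : ℝ), windowDet s (ω δ / v) ≠ 0 :=
    (tendsto_windowDet hω).eventually_ne (by simp [hs.ne'])
  have hpos : ∀ᶠ δ : ℝ in 𝓝[>] 0, 0 < δ := eventually_mem_nhdsWithin
  have hall := hu.and (hwin.and hpos)
  obtain ⟨δ₀, h1, h2, h3⟩ := hall.exists
  have hsq := h1.sq_ne_sq hℓ hs h3.ne' h2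
  have hne : ∀ᶠ δ : ℝ in 𝓝[>] 0, δ ≠ 0 ∧ ω δ ≠ 0 := hall.mono fun δ h =>
    ⟨h.2.2.ne', h.1.frequency_ne_zero hℓ hs h.2.2 h.2.1⟩
  have hpar := hall.mono fun δ h => h.1.exists_parity hℓ hs h.2.2.ne' h.2.1
  set S : Set ℝ := {δ | HasEvenDispersion ℓ s v v₁ v₂ δ (ω δ) (u δ)}
  refine HasLimitPairs.of_inf_principal S ?_ ?_
  · rcases eq_or_neBot (𝓝[>] (0 : ℝ) ⊓ 𝓟 S) with hb | hb
    · rw [hb]; exact HasLimitPairs.of_bot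
    · exact hasLimitPairs_even hℓ hs hv hv₁ hv₂ (hl.mono_left inf_le_left)
        (hω.mono_left inf_le_left) (hne.filter_mono inf_le_left)
        (eventually_inf_principal.2 (Eventually.of_forall fun δ hδ => hδ))
  · refine hasLimitPairs_odd hℓ hs hv hv₁ hv₂ hsq (hl.mono_left inf_le_left)
      (hω.mono_left inf_le_left) ((hne.mono fun δ h => h.1).filter_mono inf_le_left)
      (eventually_inf_principal.2 (hpar.mono fun δ h hδ => h.resolve_left hδ))

end DimerChain

open DimerChain in
theorem mainTheorem11 (ℓ s : ℝ) (hℓ : 0 < ℓ) (hs : 0 < s)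
    (v v₁ v₂ : ℂ) (hv : v ≠ 0) (hv₁ : v₁ ≠ 0) (hv₂ : v₂ ≠ 0)
    (ω : ℝ → ℂ) (u : ℝ → ℝ → ℂ)
    (hω : Tendsto ω (𝓝[>] 0) (𝓝 0))
    (hu : ∀ᶠ δ in 𝓝[>] (0 : ℝ), IsLocalisedMode ℓ s v v₁ v₂ δ (ω δ) (u δ)) :
    ∃ b b' μ : ℝ → ℂ,
      (∀ᶠ δ in 𝓝[>] (0 : ℝ),
        IsDecayRatio ℓ s (u δ) (b' δ) ∧
        ‖b δ‖ ≤ 1 ∧ (‖v₁‖ ≠ ‖v₂‖ → ‖b δ‖ < 1) ∧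
        (∀ (α : ℝ) (C : Matrix (Fin 2) (Fin 2) ℂ), IsCapacitanceMatrix ℓ s α C →
          ∃ x : Fin 2 → ℂ, x ≠ 0 ∧
            (C * matA (b δ)).mulVec x = μ δ • (matB δ v₁ v₂ (b δ)).mulVec x) ∧
        (b δ ≠ -(v₁ ^ 2 / v₂ ^ 2) →
          IsUnit (matB δ v₁ v₂ (b δ)) ∧
          ∀ (α : ℝ) (C : Matrix (Fin 2) (Fin 2) ℂ), IsCapacitanceMatrix ℓ s α C →
            Module.End.HasEigenvalue
              (Matrix.toLin' ((matB δ v₁ v₂ (b δ))⁻¹ * C * matA (b δ))) (μ δ))) ∧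
      Tendsto (fun δ => b' δ - b δ) (𝓝[>] 0) (𝓝 0) ∧
      (fun δ => ℓ * ω δ ^ 2 - μ δ) =o[𝓝[>] 0] (fun δ : ℝ => δ) := by
  obtain ⟨b, b', r, h, hb, hr⟩ := hasLimitPairs hℓ hs hv hv₁ hv₂ hω hu
  have hpos : ∀ᶠ δ : ℝ in 𝓝[>] 0, 0 < δ := eventually_mem_nhdsWithin
  refine ⟨b, b', fun δ => δ * r δ, ?_, hb, ?_⟩
  · filter_upwards [h, hpos] with δ h1 hδ
    obtain ⟨h2, h3⟩ := h1
    refine ⟨h2, h3.1, h3.2.1, fun α C hC => h3.exists_eigenvector hℓ hs hδ.ne' hC, fun hne => ?_⟩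
    have hB := h3.isUnit_matB hδ.ne' hv₁ hv₂ hne
    refine ⟨hB, fun α C hC => ?_⟩
    obtain ⟨x, hx, hx'⟩ := h3.exists_eigenvector hℓ hs hδ.ne' hC
    exact hasEigenvalue_of_generalised hB hx hx'
  · have h1 : (fun δ : ℝ => (δ : ℂ) * (ℓ * ω δ ^ 2 / δ - r δ)) =o[𝓝[>] 0] fun δ : ℝ => δ := by
      have h2 := (Asymptotics.isBigO_refl (fun δ : ℝ => (δ : ℂ)) (𝓝[>] 0)).mul_isLittleO
        ((Asymptotics.isLittleO_one_iff ℂ).2 hr)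
      simp only [mul_one] at h2
      exact h2.trans_isBigO (Asymptotics.isBigO_of_le _ fun δ => by simp)
    refine h1.congr' ?_ EventuallyEq.rfl
    filter_upwards [hpos] with δ hδ
    have hδ' : (δ : ℂ) ≠ 0 := by exact_mod_cast hδ.ne'
    field_simp
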